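/- **Composition for oriented tangles.** Work over $A=\mathbb Z[q^{1/2},q^{-1/2}]$. *Diagrams.* Let $D_0$ be a closed disc in an oriented sphere $S$ and $D_1,\dots,D_m\subset \operatorname{int} D_0$ ($m\ge 0$) disjoint closed discs, with a marked point on every $\partial D_i$, $i\geq 0$. An oriented tangle diagram $T$ with signature $(n_0;n_1,\dots,n_m)$ is an oriented tangle diagram with finitely many crossings drawn in $\Sigma=D_0\setminus\bigcup_{i\ge1}\operatorname{int}D_i$ which meets $\partial D_i$ in $2n_i$ points away from the marked point; these are ordered, starting at the marked point, by the orientation of $\partial D_i$ as the boundary of $D_i$. A planar diagram is a diagram without crossings (and without orientation). Diagrams are considered as combinatorial maps on the sphere. *Modules.* A cleaved link with $2n$ points consists of a noncrossing perfect matching of $2n$ ordered points on an oriented marked circle $C\subset S$ by arcs inside $C$, another one by arcs outside $C$, and a sign $\pm$ for each circle so formed. $\mathcal I_{2n}$ is the free $A$-module with basis $I_L$, $L$ a cleaved link with $2n$ points. *Partition maps.* For a planar diagram $P$ with signature $(n_0;n_1,\dots,n_m)$ let $\mathcal M(P)$ be the set of decorated multiply cleaved links over $P$: choices of noncrossing perfect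 matchings of the boundary points, by arcs outside $D_0$ and by arcs inside each $D_i$, $i\ge1$, together with a sign for each circle of the resulting union $M$ of $P$ with these arcs. The boundary $\partial_iM$ is the cleaved link consisting of the circles of $M$ that meet $\partial D_i$, with their signs, and $$W(M)=\prod_{C}q^{\pm(1-\frac12N(C))},$$ the product over all circles $C$ of $M$, with $\pm$ the sign of $C$ and $N(C)$ the number of $i\ge 0$ such that $C$ meets $\partial D_i$. The partition map $Z_P:\mathcal I_{2n_1}\otimes\cdots\otimes\mathcal I_{2n_m}\to\mathcal I_{2n_0}$ (tensor products over $A$) is the $A$-linear map with $$Z_P(I_{L_1}\otimes\cdots\otimes I_{L_m})=\sum_{M\in\mathcal M(P),\ \partial_iM=L_i\,(i\ge1)}W(M)\,I_{\partial_0M}.$$ For an oriented tangle diagram $T$ with $n_+$ positive and $n_-$ negative crossings put $$Z_T=(-1)^{n_-}q^{\,n_+-2n_-}\sum_{\rho}(-q)^{h(\rho)}Z_{\rho(T)},$$ where $\rho$ runs over the maps from the crossings of $T$ to $\{0,1\}$, $h(\rho)=\sum_c\rho(c)$, and $\rho(T)$ is the planar diagram obtained by replacing every crossing $c$ by its $\rho(c)$-resolution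 (the $0$-resolution being the orientation-compatible one exactly at positive crossings). *Composition.* Let $R$ and $T$ be oriented tangle diagrams with signatures $(n'_0;n'_1,\dots,n'_{m'})$ and $(n_0;n_1,\dots,n_m)$, let $1\le i\le m'$ and $n_0=n'_i$. Then $R\circ_iT$ is obtained by replacing the disc $D'_i$ of $R$ by the disc $D_0$ of $T$, gluing marked point to marked point and boundary points in order; its inside discs are $D'_1,\dots,D'_{i-1},D_1,\dots,D_m,D'_{i+1},\dots,D'_{m'}$. It is defined as an oriented tangle diagram if at each glued point the orientations of $R$ and $T$ fit together. For linear maps $f:\bigotimes_j\mathcal I_{2n'_j}\to\mathcal I_{2n'_0}$ and $g:\bigotimes_k\mathcal I_{2n_k}\to\mathcal I_{2n'_i}$, $f\circ_ig$ is the linear map $$a_1\otimes\cdots\otimes a_{i-1}\otimes b_1\otimes\cdots\otimes b_m\otimes a_{i+1}\otimes\cdots\otimes a_{m'}\mapsto f\big(a_1\otimes\cdots\otimes a_{i-1}\otimes g(b_1\otimes\cdots\otimes b_m)\otimes a_{i+1}\otimes\cdots\otimes a_{m'}\big).$$ **Proposition.** If $R\circ_iT$ is defined as an oriented tangle diagram,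 then $$Z_{R\circ_iT}=Z_R\circ_iZ_T .$$ -/

import Mathlib

open scoped TensorProduct

noncomputable section

namespace CleavedTangle

/-! ### The ground ring and the modules generated by cleaved links -/

/-- The ring `ℤ[q^{1/2}, q^{-1/2}]`; the Laurent monomial `T k` stands for `q^{k/2}`. -/
abbrev Coeff : Type := LaurentPolynomial ℤ

/-- The element `q`. -/
def q : Coeff := LaurentPolynomial.T 2

/-- A planar (noncrossing, perfect) matching of `2n` ordered points on the boundary of a disc,
that is, the isotopy class rel boundary of `n` disjoint properly embedded arcs in the disc. -/
structure NCMatching (n : ℕ) where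
  perm : Equiv.Perm (Fin (2 * n))
  perm_perm : ∀ a, perm (perm a) = a
  perm_ne : ∀ a, perm a ≠ a
  noncrossing : ∀ a b, ¬ (a < b ∧ b < perm a ∧ perm a < perm b)

instance (n : ℕ) : Finite (NCMatching n) :=
  Finite.of_injective (fun m : NCMatching n => m.perm) (by
    rintro ⟨_, _, _, _⟩ ⟨_, _, _, _⟩ h
    simpa using h)

/-- The components of the link on the sphere obtained from a matching inside and a matching
outside the equator (every component meets one of the `2n` points). -/
def CleavedCircle {n : ℕ} (inside outside : NCMatching n) : Type :=
  Quot (fun a b : Fin (2 * n) => b = inside.perm a ∨ b = outside.perm a)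

/-- A cleaved link with `2n` points on the equator: up to orientation preserving diffeomorphism
(preserving the equator, its sides and the marked point) it is a matching inside, a matching
outside, and a decoration of the components by signs. -/
structure CleavedLink (n : ℕ) where
  inside : NCMatching n
  outside : NCMatching n
  sign : CleavedCircle inside outside → ℤˣ

instance {n : ℕ} (a b : NCMatching n) : Finite (CleavedCircle a b) :=
  inferInstanceAs (Finite (Quot _))

instance (n : ℕ) : Finite (CleavedLink n) :=
  Finite.of_injective
    (fun L : CleavedLink n =>
      (⟨(L.inside, L.outside), L.sign⟩ :
        Σ p : NCMatching n × NCMatching n, (CleavedCircle p.1 p.2 → ℤˣ)))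
    (by
      rintro ⟨a, b, s⟩ ⟨a', b', s'⟩ h
      simp only [Sigma.mk.injEq, Prod.mk.injEq] at h
      obtain ⟨⟨rfl, rfl⟩, h⟩ := h
      cases h
      rfl)

instance (n : ℕ) : Fintype (CleavedLink n) := Fintype.ofFinite _

/-- The free `ℤ[q^{1/2}, q^{-1/2}]`-module `I_{2n}` on the cleaved links with `2n` points. -/
abbrev CleavedModule (n : ℕ) : Type := CleavedLink n →₀ Coeff

/-! ### Diagrams of arcs and circles, subordinate to discs -/

/-- A diagram on `Σ = D₀ \ ⋃ᵢ int Dᵢ` is cut into segments. An end of a segment is an interior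
end (an element of `K`), or one of the `2 nᵢ` points on `∂Dᵢ`, or one of the `2 n₀` points on
`∂D₀`. The points on each boundary circle are numbered from the marked point on, in the direction
in which the circle is oriented as the boundary of `Dᵢ` or `D₀`. -/
abbrev Ends (K : Type) {ι : Type*} (n : ι → ℕ) (n₀ : ℕ) : Type _ :=
  K ⊕ (Σ i, Fin (2 * n i)) ⊕ Fin (2 * n₀)

/-- The `a`-th point on the boundary of the inside disc `Dᵢ`. -/
abbrev innerEnd {K : Type} {ι : Type*} {n : ι → ℕ} {n₀ : ℕ} (i : ι) (a : Fin (2 * n i)) :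
    Ends K n n₀ := Sum.inr (Sum.inl ⟨i, a⟩)

/-- The `a`-th point on the boundary of the outermost disc `D₀`. -/
abbrev outerEnd {K : Type} {ι : Type*} {n : ι → ℕ} {n₀ : ℕ} (a : Fin (2 * n₀)) :
    Ends K n n₀ := Sum.inr (Sum.inr a)

/-- The points on the boundary of `Dᵢ` (for `some i`) or of `D₀` (for `none`). -/
def discEnds {K : Type} {ι : Type*} {n : ι → ℕ} {n₀ : ℕ} : Option ι → Set (Ends K n n₀)
  | none => Set.range outerEnd
  | some i => Set.range (innerEnd i)

/-- A crossingless diagram: arcs and circles, cut at finitely many interior points into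
segments. `edge` exchanges the two ends of a segment, and `join` exchanges the two segment ends
that meet at a cutting point. -/
structure ArcDiagram {ι : Type*} (n : ι → ℕ) (n₀ : ℕ) where
  Pt : Type
  [finite_Pt : Finite Pt]
  join : Equiv.Perm Pt
  join_join : ∀ p, join (join p) = p
  join_ne : ∀ p, join p ≠ p
  edge : Equiv.Perm (Ends Pt n n₀)
  edge_edge : ∀ e, edge (edge e) = e
  edge_ne : ∀ e, edge e ≠ e

attribute [instance] ArcDiagram.finite_Pt

/-- A choice of planar matchings outside `D₀` and inside every `Dᵢ`, i.e. of a multiply cleaved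
link whose associated planar diagram is `P`. -/
structure Filling {ι : Type*} {n : ι → ℕ} {n₀ : ℕ} (P : ArcDiagram n n₀) where
  outer : NCMatching n₀
  inner : ∀ i, NCMatching (n i)

namespace Filling

variable {ι : Type*} {n : ι → ℕ} {n₀ : ℕ} {P : ArcDiagram n n₀}

/-- How to continue through the end of a segment: at a cutting point through the cutting point,
at a boundary point along the matching. -/
def link (F : Filling P) : Equiv.Perm (Ends P.Pt n n₀) :=
  Equiv.sumCongr P.join
    (Equiv.sumCongr (Equiv.sigmaCongrRight fun i => (F.inner i).perm) F.outer.perm)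

/-- The circles of the multiply cleaved link. -/
def Circle (F : Filling P) : Type _ :=
  Quot (fun d e : Ends P.Pt n n₀ => e = P.edge d ∨ e = F.link d)

/-- The circle through a given segment end. -/
def circleOf (F : Filling P) (e : Ends P.Pt n n₀) : F.Circle := Quot.mk _ e

/-- `N(C)`, the number of discs, `D₀` included, whose boundary meets the circle `C`. -/
def numDiscs (F : Filling P) (C : F.Circle) : ℕ :=
  Nat.card {a : Option ι // ∃ e ∈ discEnds a, F.circleOf e = C}

/-- Two segment ends are connected in the multiply cleaved link without using the arcs of the
matching at the disc `a` (the matching inside `Dᵢ` for `a = some i`, the one outside `D₀` for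
`a = none`). Two different points of `∂Dᵢ` are so connected exactly when they are the two ends of
one arc of the link outside `Dᵢ`; two points of `∂D₀`, when they are the ends of one arc inside
`D₀`. -/
def ConnectedOff (F : Filling P) (a : Option ι) : Ends P.Pt n n₀ → Ends P.Pt n n₀ → Prop :=
  Relation.EqvGen (fun d e => e = P.edge d ∨ (d ∉ discEnds a ∧ e = F.link d))

instance [Finite ι] (F : Filling P) : Finite F.Circle := inferInstanceAs (Finite (Quot _))

instance [Finite ι] (F : Filling P) : Fintype F.Circle := Fintype.ofFinite _

instance [Finite ι] : Finite (Filling P) :=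
  Finite.of_injective (fun F : Filling P => (F.outer, F.inner)) (by
    rintro ⟨_, _⟩ ⟨_, _⟩ h
    simpa using h)

end Filling

/-- The set `M(P)` of decorated, multiply cleaved links with associated planar diagram `P`. -/
structure MultiplyCleaved {ι : Type*} {n : ι → ℕ} {n₀ : ℕ} (P : ArcDiagram n n₀) where
  fill : Filling P
  sign : fill.Circle → ℤˣ

namespace MultiplyCleaved

variable {ι : Type*} {n : ι → ℕ} {n₀ : ℕ} {P : ArcDiagram n n₀}

instance [Finite ι] : Finite (MultiplyCleaved P) :=
  Finite.of_injective
    (fun M : MultiplyCleaved P => (⟨M.fill, M.sign⟩ : Σ F : Filling P, (F.Circle → ℤˣ)))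
    (by
      rintro ⟨F, s⟩ ⟨F', s'⟩ h
      simp only [Sigma.mk.injEq] at h
      obtain ⟨rfl, h⟩ := h
      cases h
      rfl)

instance [Finite ι] : Fintype (MultiplyCleaved P) := Fintype.ofFinite _

/-- The weight: a circle `C` with sign `±` contributes the factor `q^{± (1 - N(C)/2)}`. -/
def weight [Finite ι] (M : MultiplyCleaved P) : Coeff :=
  ∏ C : M.fill.Circle, LaurentPolynomial.T ((M.sign C : ℤ) * (2 - (M.fill.numDiscs C : ℤ)))

/-- `∂₀ M = L`. -/
def HasOuterBoundary (M : MultiplyCleaved P) (L : CleavedLink n₀) : Prop :=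
  L.outside = M.fill.outer ∧
  (∀ a, M.fill.ConnectedOff none (outerEnd a) (outerEnd (L.inside.perm a))) ∧
  ∀ a, L.sign (Quot.mk _ a) = M.sign (M.fill.circleOf (outerEnd a))

/-- `∂ᵢ M = L`, for an inside disc `Dᵢ`. -/
def HasInnerBoundary (M : MultiplyCleaved P) (i : ι) (L : CleavedLink (n i)) : Prop :=
  L.inside = M.fill.inner i ∧
  (∀ a, M.fill.ConnectedOff (some i) (innerEnd i a) (innerEnd i (L.outside.perm a))) ∧
  ∀ a, L.sign (Quot.mk _ a) = M.sign (M.fill.circleOf (innerEnd i a))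

end MultiplyCleaved

namespace ArcDiagram

variable {ι : Type*} {n : ι → ℕ} {n₀ : ℕ}

open scoped Classical in
/-- The sum of the weights over the set `M_P(L₀; (Lᵢ)ᵢ)` of all decorated multiply cleaved links
`M` over `P` with `∂₀ M = L₀` and `∂ᵢ M = Lᵢ` for all `i`. -/
def coefficient [Finite ι] (P : ArcDiagram n n₀) (L₀ : CleavedLink n₀)
    (L : ∀ i, CleavedLink (n i)) : Coeff :=
  ∑ M : MultiplyCleaved P,
    if M.HasOuterBoundary L₀ ∧ ∀ i, M.HasInnerBoundary i (L i) then M.weight else 0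

/-- The partition map `Z_P`: the linear extension of
`⨂ᵢ I_{Lᵢ} ↦ ∑ W(M) I_{∂₀ M}`, the sum over all `M` over `P` with `∂ᵢ M = Lᵢ` for all `i`. -/
def partitionMap [Finite ι] (P : ArcDiagram n n₀) :
    (⨂[Coeff] i, CleavedModule (n i)) →ₗ[Coeff] CleavedModule n₀ :=
  (Basis.piTensorProduct (R := Coeff) (M := fun i => CleavedModule (n i))
      fun _ => Finsupp.basisSingleOne).constr Coeff fun L =>
    ∑ L₀ : CleavedLink n₀, Finsupp.single L₀ (P.coefficient L₀ L)

end ArcDiagram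

/-! ### Oriented tangle diagrams -/

/-- An oriented tangle diagram with signature `(n₀; (nᵢ)ᵢ)`, as a combinatorial map: crossings `X`,
cutting points (of which there may be arbitrarily many, pairs of elements of `Pt`), and segments.
The four segment ends at a crossing `x` are `(x, 0), (x, 1), (x, 2), (x, 3)` in counterclockwise
order; the strand through `(x, 0), (x, 2)` passes under the strand through `(x, 1), (x, 3)`.
`out e` says that the segment with end `e` is oriented away from that end. -/
structure OrientedTangleDiagram {ι : Type*} (n : ι → ℕ) (n₀ : ℕ) where
  X : Type
  [finite_X : Finite X]
  Pt : Type
  [finite_Pt : Finite Pt]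
  join : Equiv.Perm Pt
  join_join : ∀ p, join (join p) = p
  join_ne : ∀ p, join p ≠ p
  edge : Equiv.Perm (Ends ((X × ZMod 4) ⊕ Pt) n n₀)
  edge_edge : ∀ e, edge (edge e) = e
  edge_ne : ∀ e, edge e ≠ e
  out : Ends ((X × ZMod 4) ⊕ Pt) n n₀ → Bool
  out_edge : ∀ e, out (edge e) = !out e
  out_cross : ∀ x k, out (Sum.inl (Sum.inl (x, k + 2))) = !out (Sum.inl (Sum.inl (x, k)))
  out_join : ∀ p, out (Sum.inl (Sum.inr (join p))) = !out (Sum.inl (Sum.inr p))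

attribute [instance] OrientedTangleDiagram.finite_X OrientedTangleDiagram.finite_Pt

/-- The number of cycles of a permutation, fixed points included. -/
def numCycles {α : Type*} (f : Equiv.Perm α) : ℕ :=
  Nat.card (Quotient (Equiv.Perm.SameCycle.setoid f))

namespace OrientedTangleDiagram

variable {ι : Type*} {n : ι → ℕ} {n₀ : ℕ}

/-- Each crossing and each cutting point, each inside disc `Dᵢ`, and the disc outside `D₀`
(collapsed to points of the sphere) are vertices of a graph on the sphere. This permutation takes a
segment end to the next one counterclockwise around the same vertex. The boundary of the disc
outside `D₀` is oriented oppositely to `∂D₀`. -/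
def rotation (T : OrientedTangleDiagram n n₀) :
    Equiv.Perm (Ends ((T.X × ZMod 4) ⊕ T.Pt) n n₀) :=
  Equiv.sumCongr
    (Equiv.sumCongr (Equiv.prodCongr (Equiv.refl T.X) (Equiv.addRight (1 : ZMod 4))) T.join)
    (Equiv.sumCongr (Equiv.sigmaCongrRight fun i => finRotate (2 * n i)) (finRotate (2 * n₀)).symm)

/-- The diagram is drawn on the sphere: by Euler's formula, the number of vertices plus the number
of faces equals the number of edges plus twice the number of connected components. (Discs without
boundary points would add isolated vertices, which do not change this condition.) -/
def IsPlanar (T : OrientedTangleDiagram n n₀) : Prop :=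
  numCycles T.rotation + numCycles (T.rotation * T.edge) =
    numCycles T.edge +
      2 * Nat.card (Quotient
        (Equiv.Perm.SameCycle.setoid T.rotation ⊔ Equiv.Perm.SameCycle.setoid T.edge))

/-- A crossing is positive when a counterclockwise rotation by less than `π` turns the direction of
the over strand into the direction of the under strand: the outgoing ends of the two strands are
then the ends `1, 2` or the ends `3, 0`. -/
def IsPositive (T : OrientedTangleDiagram n n₀) (x : T.X) : Prop :=
  T.out (Sum.inl (Sum.inl (x, 1))) = T.out (Sum.inl (Sum.inl (x, 2)))

/-- `n₊(T)`. -/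
def numPos (T : OrientedTangleDiagram n n₀) : ℕ := Nat.card {x : T.X // T.IsPositive x}

/-- `n₋(T)`. -/
def numNeg (T : OrientedTangleDiagram n n₀) : ℕ := Nat.card {x : T.X // ¬ T.IsPositive x}

/-- The replacement of crossings. The 0-resolution joins the ends `0, 1` and `2, 3`
(it is the oriented resolution exactly at positive crossings), the 1-resolution joins the
ends `0, 3` and `1, 2`. -/
def smoothing {X : Type} (ρ : X → Fin 2) : Equiv.Perm (X × ZMod 4) where
  toFun p := (p.1, (if ρ p.1 = 0 then 1 else 3) - p.2)
  invFun p := (p.1, (if ρ p.1 = 0 then 1 else 3) - p.2)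
  left_inv p := by simp
  right_inv p := by simp

/-- The resolution diagram `ρ(T)`. -/
def resolve (T : OrientedTangleDiagram n n₀) (ρ : T.X → Fin 2) : ArcDiagram n n₀ where
  Pt := (T.X × ZMod 4) ⊕ T.Pt
  join := Equiv.sumCongr (smoothing ρ) T.join
  join_join := by
    rintro (p | p)
    · simp [smoothing]
    · simp [T.join_join]
  join_ne := by
    have key : ∀ k : ZMod 4, 1 - k ≠ k ∧ 3 - k ≠ k := by decide
    rintro (⟨x, k⟩ | p)
    · by_cases h : ρ x = 0
      · simpa [smoothing, h] using (key k).1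
      · simpa [smoothing, h] using (key k).2
    · simpa using T.join_ne p
  edge := T.edge
  edge_edge := T.edge_edge
  edge_ne := T.edge_ne

instance (T : OrientedTangleDiagram n n₀) : Fintype T.X := Fintype.ofFinite _

instance (T : OrientedTangleDiagram n n₀) : Fintype (T.X → Fin 2) := Fintype.ofFinite _

/-- The unshifted partition map `∑_ρ (-q)^{h(ρ)} Z_{ρ(T)}`, with `h(ρ) = ∑_c ρ(c)`. -/
def unshiftedMap [Finite ι] (T : OrientedTangleDiagram n n₀) :
    (⨂[Coeff] i, CleavedModule (n i)) →ₗ[Coeff] CleavedModule n₀ :=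
  ∑ ρ : T.X → Fin 2, (-q) ^ (∑ c, (ρ c : ℕ)) • (T.resolve ρ).partitionMap

/-- The partition map `Z_T = (-1)^{n₋} q^{n₊ - 2 n₋} ∑_ρ (-q)^{h(ρ)} Z_{ρ(T)}`. -/
def partitionMap [Finite ι] (T : OrientedTangleDiagram n n₀) :
    (⨂[Coeff] i, CleavedModule (n i)) →ₗ[Coeff] CleavedModule n₀ :=
  ((-1 : Coeff) ^ T.numNeg *
      LaurentPolynomial.T (2 * ((T.numPos : ℤ) - 2 * (T.numNeg : ℤ)))) • T.unshiftedMap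

end OrientedTangleDiagram

/-! ### Composition -/

section Composition

variable {κ ι : Type*} {n' : κ → ℕ} {n₀' : ℕ} {n : ι → ℕ} {i : κ}

/-- The inside discs of a composition at the disc `i` are the discs of `R` other than `i`
together with the inside discs of `T`. -/
abbrev compSig (n' : κ → ℕ) (i : κ) (n : ι → ℕ) : {j : κ // j ≠ i} ⊕ ι → ℕ :=
  Sum.elim (fun j => n' j.1) n

/-- The orientations of `R` at `∂Dᵢ` and of `T` at `∂D₀` fit together: at each glued point one
strand arrives and the other leaves. -/
def OrientationsAgree (i : κ) (R : OrientedTangleDiagram n' n₀')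
    (T : OrientedTangleDiagram n (n' i)) : Prop :=
  ∀ a, T.out (outerEnd a) = !R.out (innerEnd i a)

namespace OrientedTangleDiagram

/-- The cutting points of the composition: those of `R` and of `T`, and one for each glued point,
which has one end on the side of `R` and one on the side of `T`. -/
abbrev CompPt (i : κ) (R : OrientedTangleDiagram n' n₀') (T : OrientedTangleDiagram n (n' i)) :
    Type :=
  (R.Pt ⊕ T.Pt) ⊕ (Fin (2 * n' i) ⊕ Fin (2 * n' i))

/-- The segment ends of the composition. -/
abbrev CompEnds (i : κ) (R : OrientedTangleDiagram n' n₀') (T : OrientedTangleDiagram n (n' i)) :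
    Type _ :=
  Ends (((R.X ⊕ T.X) × ZMod 4) ⊕ CompPt i R T) (compSig n' i n) n₀'

/-- The segment ends of the composition as segment ends of `R` or of `T`. The two ends at the
`a`-th glued point are the `a`-th point of `∂Dᵢ` in `R` and the `a`-th point of `∂D₀` in `T`. -/
def unglue (i : κ) (R : OrientedTangleDiagram n' n₀') (T : OrientedTangleDiagram n (n' i)) :
    CompEnds i R T →
      Ends ((R.X × ZMod 4) ⊕ R.Pt) n' n₀' ⊕ Ends ((T.X × ZMod 4) ⊕ T.Pt) n (n' i)
  | Sum.inl (Sum.inl (Sum.inl x, k)) => Sum.inl (Sum.inl (Sum.inl (x, k)))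
  | Sum.inl (Sum.inl (Sum.inr x, k)) => Sum.inr (Sum.inl (Sum.inl (x, k)))
  | Sum.inl (Sum.inr (Sum.inl (Sum.inl p))) => Sum.inl (Sum.inl (Sum.inr p))
  | Sum.inl (Sum.inr (Sum.inl (Sum.inr p))) => Sum.inr (Sum.inl (Sum.inr p))
  | Sum.inl (Sum.inr (Sum.inr (Sum.inl a))) => Sum.inl (innerEnd i a)
  | Sum.inl (Sum.inr (Sum.inr (Sum.inr a))) => Sum.inr (outerEnd a)
  | Sum.inr (Sum.inl ⟨Sum.inl j, a⟩) => Sum.inl (innerEnd j.1 a)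
  | Sum.inr (Sum.inl ⟨Sum.inr k, a⟩) => Sum.inr (innerEnd k a)
  | Sum.inr (Sum.inr a) => Sum.inl (outerEnd a)

theorem unglue_bijective (i : κ) (R : OrientedTangleDiagram n' n₀')
    (T : OrientedTangleDiagram n (n' i)) : Function.Bijective (unglue i R T) := by
  constructor
  · have hne : ∀ (j : κ) (hj : j ≠ i) (a : Fin (2 * n' j)) (b : Fin (2 * n' i)),
        (⟨j, a⟩ : Σ j, Fin (2 * n' j)) ≠ ⟨i, b⟩ := fun j hj a b h => hj (congrArg Sigma.fst h)
    rintro (((⟨x | x, k⟩) | ((p | p) | (a | a))) | (⟨⟨j, hj⟩ | j, a⟩ | a))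
      (((⟨y | y, l⟩) | ((p' | p') | (b | b))) | (⟨⟨j', hj'⟩ | j', b⟩ | b)) h <;>
      simp only [unglue, innerEnd, outerEnd, Sum.inl.injEq, Sum.inr.injEq, reduceCtorEq] at h
    all_goals first
      | exact absurd h (hne _ hj _ _)
      | exact absurd h.symm (hne _ hj' _ _)
      | (cases h; rfl)
  · rintro ((((⟨x, k⟩) | p) | (⟨j, a⟩ | a)) | (((⟨x, k⟩) | p) | (⟨j, a⟩ | a)))
    · exact ⟨Sum.inl (Sum.inl (Sum.inl x, k)), rfl⟩
    · exact ⟨Sum.inl (Sum.inr (Sum.inl (Sum.inl p))), rfl⟩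
    · by_cases h : j = i
      · subst h
        exact ⟨Sum.inl (Sum.inr (Sum.inr (Sum.inl a))), rfl⟩
      · exact ⟨Sum.inr (Sum.inl ⟨Sum.inl ⟨j, h⟩, a⟩), rfl⟩
    · exact ⟨Sum.inr (Sum.inr a), rfl⟩
    · exact ⟨Sum.inl (Sum.inl (Sum.inr x, k)), rfl⟩
    · exact ⟨Sum.inl (Sum.inr (Sum.inl (Sum.inr p))), rfl⟩
    · exact ⟨Sum.inr (Sum.inl ⟨Sum.inr j, a⟩), rfl⟩
    · exact ⟨Sum.inl (Sum.inr (Sum.inr (Sum.inr a))), rfl⟩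

/-- The segment ends of the composition are those of `R` together with those of `T`. -/
def unglueEquiv (i : κ) (R : OrientedTangleDiagram n' n₀') (T : OrientedTangleDiagram n (n' i)) :
    CompEnds i R T ≃
      Ends ((R.X × ZMod 4) ⊕ R.Pt) n' n₀' ⊕ Ends ((T.X × ZMod 4) ⊕ T.Pt) n (n' i) :=
  Equiv.ofBijective (unglue i R T) (unglue_bijective i R T)

/-- The composition `R ∘ᵢ T`: the disc `Dᵢ` of `R` is replaced by the disc `D₀` of `T`, marked
point on marked point and with the boundary points identified in order. The crossings and the
segments of `R ∘ᵢ T` are those of `R` and of `T`, and the glued points become cutting points. -/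
def comp (i : κ) (R : OrientedTangleDiagram n' n₀') (T : OrientedTangleDiagram n (n' i))
    (h : OrientationsAgree i R T) : OrientedTangleDiagram (compSig n' i n) n₀' where
  X := R.X ⊕ T.X
  Pt := CompPt i R T
  join := Equiv.sumCongr (Equiv.sumCongr R.join T.join) (Equiv.sumComm _ _)
  join_join := by
    rintro ((p | p) | (a | a)) <;> simp [R.join_join, T.join_join]
  join_ne := by
    rintro ((p | p) | (a | a)) <;> simp [R.join_ne, T.join_ne]
  edge := ((unglueEquiv i R T).trans (Equiv.sumCongr R.edge T.edge)).trans (unglueEquiv i R T).symm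
  edge_edge e := by
    simp only [Equiv.trans_apply, Equiv.apply_symm_apply, Equiv.symm_apply_eq]
    rcases unglueEquiv i R T e with e' | e' <;> simp [R.edge_edge, T.edge_edge]
  edge_ne e := by
    simp only [Equiv.trans_apply, ne_eq, Equiv.symm_apply_eq]
    rcases unglueEquiv i R T e with e' | e' <;> simp [R.edge_ne, T.edge_ne]
  out e := Sum.elim R.out T.out (unglue i R T e)
  out_edge e := by
    have hu : ∀ e, unglue i R T e = unglueEquiv i R T e := fun _ => rfl
    simp only [hu, Equiv.trans_apply, Equiv.apply_symm_apply]
    rcases unglueEquiv i R T e with e' | e' <;> simp [R.out_edge, T.out_edge]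
  out_cross := by
    rintro (x | x) k
    · exact R.out_cross x k
    · exact T.out_cross x k
  out_join := by
    rintro ((p | p) | (a | a))
    · exact R.out_join p
    · exact T.out_join p
    · exact h a
    · show R.out (innerEnd i a) = !T.out (outerEnd a)
      rw [h a, Bool.not_not]

end OrientedTangleDiagram

/-- The tensor factors belonging to `R` in a family indexed by the
inside discs of the composition. -/
def leftPart (x : ∀ s, CleavedModule (compSig n' i n s)) (j : {j : κ // j ≠ i}) :
    CleavedModule (n' j.1) := x (Sum.inl j)

/-- The tensor factors belonging to `T`. -/
def rightPart (x : ∀ s, CleavedModule (compSig n' i n s)) (k : ι) :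
    CleavedModule (n k) := x (Sum.inr k)

/-- The family `(⋯, a_{i-1}, y, a_{i+1}, ⋯)` indexed by the inside discs of `R`. -/
def insertAt [DecidableEq κ] (y : CleavedModule (n' i))
    (a : ∀ j : {j : κ // j ≠ i}, CleavedModule (n' j.1)) (j : κ) : CleavedModule (n' j) :=
  if h : j = i then h ▸ y else a ⟨j, h⟩

theorem insertAt_self [DecidableEq κ] (y : CleavedModule (n' i))
    (a : ∀ j : {j : κ // j ≠ i}, CleavedModule (n' j.1)) : insertAt y a i = y := by
  simp [insertAt]

theorem insertAt_of_ne [DecidableEq κ] (y : CleavedModule (n' i))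
    (a : ∀ j : {j : κ // j ≠ i}, CleavedModule (n' j.1)) (j : κ) (h : j ≠ i) :
    insertAt y a j = a ⟨j, h⟩ := by
  simp [insertAt, h]

theorem insertAt_eq_update [DecidableEq κ] (y : CleavedModule (n' i))
    (a : ∀ j : {j : κ // j ≠ i}, CleavedModule (n' j.1)) :
    insertAt y a = Function.update (insertAt 0 a) i y := by
  funext j
  by_cases h : j = i
  · subst h
    rw [insertAt_self, Function.update_self]
  · rw [Function.update_of_ne h, insertAt_of_ne _ _ _ h, insertAt_of_ne _ _ _ h]

theorem insertAt_update [DecidableEq κ] [DecidableEq {j : κ // j ≠ i}] (y : CleavedModule (n' i))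
    (a : ∀ j : {j : κ // j ≠ i}, CleavedModule (n' j.1)) (j : {j : κ // j ≠ i})
    (z : CleavedModule (n' j.1)) :
    insertAt y (Function.update a j z) = Function.update (insertAt y a) j.1 z := by
  funext k
  by_cases h : k = i
  · subst h
    rw [Function.update_of_ne (Ne.symm j.2), insertAt_self, insertAt_self]
  · rw [insertAt_of_ne _ _ _ h]
    by_cases hk : k = j.1
    · subst hk
      rw [Function.update_self, Function.update_self]
    · rw [Function.update_of_ne hk, insertAt_of_ne _ _ _ h, Function.update_of_ne]
      exact fun e => hk (congrArg Subtype.val e)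

section Update

variable [DecidableEq ({j : κ // j ≠ i} ⊕ ι)] (x : ∀ s, CleavedModule (compSig n' i n s))

theorem leftPart_update_inl [DecidableEq {j : κ // j ≠ i}] (j : {j : κ // j ≠ i})
    (z : CleavedModule (n' j.1)) :
    leftPart (Function.update x (Sum.inl j) z) = Function.update (leftPart x) j z :=
  Function.update_comp_eq_of_injective' x Sum.inl_injective j z

theorem leftPart_update_inr (k : ι) (z : CleavedModule (n k)) :
    leftPart (Function.update x (Sum.inr k) z) = leftPart x := by
  funext j
  exact Function.update_of_ne (Sum.inl_ne_inr : Sum.inl j ≠ Sum.inr k) _ _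

theorem rightPart_update_inl (j : {j : κ // j ≠ i}) (z : CleavedModule (n' j.1)) :
    rightPart (Function.update x (Sum.inl j) z) = rightPart x := by
  funext k
  exact Function.update_of_ne (Sum.inr_ne_inl : Sum.inr k ≠ Sum.inl j) _ _

theorem rightPart_update_inr [DecidableEq ι] (k : ι) (z : CleavedModule (n k)) :
    rightPart (Function.update x (Sum.inr k) z) = Function.update (rightPart x) k z :=
  Function.update_comp_eq_of_injective' x Sum.inr_injective k z

end Update

/-- The element `f (⋯ ⊗ a_{i-1} ⊗ g (⨂ b_k) ⊗ a_{i+1} ⊗ ⋯)`. -/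
def compValue [DecidableEq κ] (i : κ)
    (f : (⨂[Coeff] j, CleavedModule (n' j)) →ₗ[Coeff] CleavedModule n₀')
    (g : (⨂[Coeff] k, CleavedModule (n k)) →ₗ[Coeff] CleavedModule (n' i))
    (a : ∀ j : {j : κ // j ≠ i}, CleavedModule (n' j.1)) (b : ∀ k, CleavedModule (n k)) :
    CleavedModule n₀' :=
  f (PiTensorProduct.tprod Coeff (insertAt (g (PiTensorProduct.tprod Coeff b)) a))

section Multilinear

variable [DecidableEq κ]
  (f : (⨂[Coeff] j, CleavedModule (n' j)) →ₗ[Coeff] CleavedModule n₀')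
  (g : (⨂[Coeff] k, CleavedModule (n k)) →ₗ[Coeff] CleavedModule (n' i))
  (a : ∀ j : {j : κ // j ≠ i}, CleavedModule (n' j.1)) (b : ∀ k, CleavedModule (n k))

theorem compValue_left_add [DecidableEq {j : κ // j ≠ i}] (j : {j : κ // j ≠ i})
    (y z : CleavedModule (n' j.1)) :
    compValue i f g (Function.update a j (y + z)) b =
      compValue i f g (Function.update a j y) b + compValue i f g (Function.update a j z) b := by
  simp only [compValue, insertAt_update, MultilinearMap.map_update_add, map_add]

theorem compValue_left_smul [DecidableEq {j : κ // j ≠ i}] (j : {j : κ // j ≠ i})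
    (c : Coeff) (y : CleavedModule (n' j.1)) :
    compValue i f g (Function.update a j (c • y)) b =
      c • compValue i f g (Function.update a j y) b := by
  simp only [compValue, insertAt_update, MultilinearMap.map_update_smul, map_smul]

theorem compValue_right_add [DecidableEq ι] (k : ι) (y z : CleavedModule (n k)) :
    compValue i f g a (Function.update b k (y + z)) =
      compValue i f g a (Function.update b k y) + compValue i f g a (Function.update b k z) := by
  simp only [compValue, MultilinearMap.map_update_add, map_add]
  rw [insertAt_eq_update, MultilinearMap.map_update_add, map_add,
    ← insertAt_eq_update, ← insertAt_eq_update]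

theorem compValue_right_smul [DecidableEq ι] (k : ι) (c : Coeff) (y : CleavedModule (n k)) :
    compValue i f g a (Function.update b k (c • y)) =
      c • compValue i f g a (Function.update b k y) := by
  simp only [compValue, MultilinearMap.map_update_smul, map_smul]
  rw [insertAt_eq_update, MultilinearMap.map_update_smul, map_smul, ← insertAt_eq_update]

end Multilinear

/-- The composition `f ∘ᵢ g` of linear maps along the `i`-th tensor factor of the domain of `f`:
the tensor product of the `a_j`, `j ≠ i`, and the `b_k` goes to
`f (⋯ ⊗ a_{i-1} ⊗ g (⨂ b_k) ⊗ a_{i+1} ⊗ ⋯)`. -/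
def compAt [DecidableEq κ] (i : κ)
    (f : (⨂[Coeff] j, CleavedModule (n' j)) →ₗ[Coeff] CleavedModule n₀')
    (g : (⨂[Coeff] k, CleavedModule (n k)) →ₗ[Coeff] CleavedModule (n' i)) :
    (⨂[Coeff] s, CleavedModule (compSig n' i n s)) →ₗ[Coeff] CleavedModule n₀' :=
  PiTensorProduct.lift
    { toFun := fun x => compValue i f g (leftPart x) (rightPart x)
      map_update_add' := by
        intro _ x s y z
        classical
        rcases s with j | k
        · erw [rightPart_update_inl, rightPart_update_inl, rightPart_update_inl,
            leftPart_update_inl, leftPart_update_inl, leftPart_update_inl]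
          exact compValue_left_add f g _ _ j y z
        · erw [rightPart_update_inr, rightPart_update_inr, rightPart_update_inr,
            leftPart_update_inr, leftPart_update_inr, leftPart_update_inr]
          exact compValue_right_add f g _ _ k y z
      map_update_smul' := by
        intro _ x s c y
        classical
        rcases s with j | k
        · erw [rightPart_update_inl, rightPart_update_inl,
            leftPart_update_inl, leftPart_update_inl]
          exact compValue_left_smul f g _ _ j c y
        · erw [rightPart_update_inr, rightPart_update_inr,
            leftPart_update_inr, leftPart_update_inr]
          exact compValue_right_smul f g _ _ k c y }

theorem compAt_tprod [DecidableEq κ]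
    (f : (⨂[Coeff] j, CleavedModule (n' j)) →ₗ[Coeff] CleavedModule n₀')
    (g : (⨂[Coeff] k, CleavedModule (n k)) →ₗ[Coeff] CleavedModule (n' i))
    (x : ∀ s, CleavedModule (compSig n' i n s)) :
    compAt i f g (PiTensorProduct.tprod Coeff x) =
      compValue i f g (leftPart x) (rightPart x) := by
  exact PiTensorProduct.lift.tprod _

end Composition

end CleavedTangle

end

open scoped TensorProduct

noncomputable section

namespace CleavedTangle

/-! ### Face colourings of planar maps -/

section Colouring

variable {E : Type*}

/-! The theorem is the locality of a state sum along the glued circle. Cutting a decorated link `M`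
over the composition there gives a decorated link over each part, and the two parts share a cleaved
link `K` on that circle. Conversely, two parts with a common `K` glue to exactly one `M`. Hence each
coefficient of the glued crossingless diagram is the sum over `K` of products of coefficients of the
parts (`Gluing.coefficient_eq_sum`). This is composition of linear maps written in bases
(`Gluing.partitionMap_eq`).

Two facts carry this. The first is that the arcs of either part induce a noncrossing matching on the
glued circle; only here does genus zero enter. Diagrams are combinatorial maps, so mod 2 homology
replaces the Jordan curve theorem: by Euler's formula, a set of edges with even degree at every
vertex bounds a set of faces (`exists_face_colouring`). An arc with both ends on a disc, collapsed
to a vertex, is such a set. Any other arc keeps its face colour all the way, so the ends of the two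
arcs do not interleave (`exists_ncMatching`).

The second is that weights multiply (`Gluing.Decorated.weight_eq`). An excursion into the other part
can be replaced by the matching arc with the same ends, so a circle of `M` restricts to at most one
circle on each side. A circle through the glued circle comes from circles with disc numbers `N₁` and
`N₂` and has `N = N₁ + N₂ - 2`, so the exponents `1 - N/2` add up; any other circle keeps its disc
number.

With crossings, a resolution of the composition is a pair of resolutions, heights and crossing
numbers are additive, and composition of linear maps is bilinear. -/

/-- The functions that are constant on the classes of a setoid. -/
def classFunctions (s : Setoid E) : Submodule (ZMod 2) (E → ZMod 2) where
  carrier := {f | ∀ a b, s a b → f a = f b}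
  add_mem' hf hg a b h := by simp [hf a b h, hg a b h]
  zero_mem' _ _ _ := rfl
  smul_mem' c f hf a b h := by simp [hf a b h]

theorem mem_classFunctions_sameCycle {σ : Equiv.Perm E} {f : E → ZMod 2} :
    f ∈ classFunctions (Equiv.Perm.SameCycle.setoid σ) ↔ ∀ e, f (σ e) = f e := by
  constructor
  · intro h e
    exact (h e (σ e) ⟨1, by simp⟩).symm
  · rintro h a b ⟨k, rfl⟩
    have hz : ∀ (k : ℤ) (a : E), f ((σ ^ k) a) = f a := by
      intro k
      induction k with
      | zero => simp
      | succ n ih => intro a; rw [zpow_add_one, Equiv.Perm.mul_apply, ih, h]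
      | pred n ih =>
        intro a
        rw [zpow_sub_one, Equiv.Perm.mul_apply, ih, ← h (σ⁻¹ a), ← Equiv.Perm.mul_apply,
          mul_inv_cancel, Equiv.Perm.one_apply]
    exact (hz k a).symm

/-- Class functions are the functions on the quotient. -/
def classFunctionsEquiv (s : Setoid E) :
    classFunctions s ≃ₗ[ZMod 2] (Quotient s → ZMod 2) where
  toFun f := Quotient.lift f.1 f.2
  map_add' f g := by ext x; induction x using Quotient.inductionOn; rfl
  map_smul' c f := by ext x; induction x using Quotient.inductionOn; rfl
  invFun g := ⟨fun e => g ⟦e⟧, fun a b h => congrArg g (Quotient.sound h)⟩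
  left_inv f := rfl
  right_inv g := by ext x; induction x using Quotient.inductionOn; rfl

theorem finrank_classFunctions [Finite E] (s : Setoid E) :
    Module.finrank (ZMod 2) (classFunctions s) = Nat.card (Quotient s) := by
  have := Fintype.ofFinite (Quotient s)
  rw [(classFunctionsEquiv s).finrank_eq, Module.finrank_fintype_fun_eq_card,
    Nat.card_eq_fintype_card]

theorem classFunctions_inf (s t : Setoid E) :
    classFunctions s ⊓ classFunctions t = classFunctions (s ⊔ t) := by
  ext f
  constructor
  · rintro ⟨h₁, h₂⟩ a b hab
    have : s ⊔ t ≤ Setoid.ker f := sup_le (fun {a b} h => h₁ a b h) (fun {a b} h => h₂ a b h)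
    exact this hab
  · intro h
    exact ⟨fun a b hab => h a b ((le_sup_left : s ≤ s ⊔ t) hab),
      fun a b hab => h a b ((le_sup_right : t ≤ s ⊔ t) hab)⟩

/-- The map `f ↦ f + f ∘ α`. -/
def coboundary (α : Equiv.Perm E) : (E → ZMod 2) →ₗ[ZMod 2] (E → ZMod 2) :=
  LinearMap.id + LinearMap.funLeft (ZMod 2) (ZMod 2) α

theorem coboundary_apply (α : Equiv.Perm E) (f : E → ZMod 2) (e : E) :
    coboundary α f e = f e + f (α e) := rfl

theorem ker_coboundary (α : Equiv.Perm E) :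
    LinearMap.ker (coboundary α) = classFunctions (Equiv.Perm.SameCycle.setoid α) := by
  ext f
  rw [mem_classFunctions_sameCycle, LinearMap.mem_ker, funext_iff]
  refine forall_congr' fun e => ?_
  rw [coboundary_apply, Pi.zero_apply, add_comm, CharTwo.add_eq_zero]

variable {σ α : Equiv.Perm E}

/-- An invariant `f` is the coboundary of the function that equals `f` at one chosen end of each
edge and 0 at the other end. -/
theorem range_coboundary (hα : ∀ e, α (α e) = e) (hne : ∀ e, α e ≠ e) :
    LinearMap.range (coboundary α) = classFunctions (Equiv.Perm.SameCycle.setoid α) := by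
  classical
  ext f
  rw [mem_classFunctions_sameCycle]
  constructor
  · rintro ⟨g, rfl⟩ e
    rw [coboundary_apply, coboundary_apply, hα, add_comm]
  · intro hf
    let s := Equiv.Perm.SameCycle.setoid α
    have hs : ∀ e, (⟦α e⟧ : Quotient s) = ⟦e⟧ := fun e => Quotient.sound ⟨1, by simp [hα]⟩
    have hout : ∀ e : E, (⟦e⟧ : Quotient s).out = e ∨ (⟦e⟧ : Quotient s).out = α e := by
      intro e
      obtain ⟨k, hk⟩ : s e (⟦e⟧ : Quotient s).out := Setoid.symm (Quotient.mk_out (s := s) e)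
      have h2 : α * α = 1 := Equiv.ext hα
      rcases Int.even_or_odd' k with ⟨j, rfl | rfl⟩
      · left
        rw [← hk, zpow_mul, zpow_two, h2, one_zpow, Equiv.Perm.one_apply]
      · right
        rw [← hk, zpow_add, zpow_mul, zpow_two, h2, one_zpow, one_mul, zpow_one]
    refine ⟨fun e => if (⟦e⟧ : Quotient s).out = e then f e else 0, ?_⟩
    ext e
    rw [coboundary_apply, hs, hf]
    rcases hout e with h | h
    · rw [if_pos h, h, if_neg (hne e).symm, add_zero]
    · rw [h, if_neg (hne e), if_pos rfl, zero_add]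

/-- Rank-nullity for `coboundary α`, whose kernel and range coincide. -/
theorem card_eq_two_mul_numCycles [Fintype E] (hα : ∀ e, α (α e) = e) (hne : ∀ e, α e ≠ e) :
    Fintype.card E = 2 * numCycles α := by
  have h := LinearMap.finrank_range_add_finrank_ker (coboundary α)
  rw [ker_coboundary, range_coboundary hα hne, finrank_classFunctions,
    Module.finrank_fintype_fun_eq_card] at h
  rw [← h, two_mul]
  rfl

/-- On a map of genus zero with rotation `σ` and edges `α`, every set `p` of edges that has even
degree at every vertex bounds a set of faces: `f` tells the colour of the face at the right of a
dart. -/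
theorem exists_face_colouring [Fintype E] (hα : ∀ e, α (α e) = e) (hne : ∀ e, α e ≠ e)
    (hplanar : numCycles σ + numCycles (σ * α) = numCycles α + 2 * Nat.card (Quotient
      (Equiv.Perm.SameCycle.setoid σ ⊔ Equiv.Perm.SameCycle.setoid α)))
    (p : E → ZMod 2) (hp : ∀ e, p (α e) = p e)
    (heven : ∀ h : E → ZMod 2, (∀ e, h (σ e) = h e) → ∑ e, p e * h e = 0) :
    ∃ f : E → ZMod 2, (∀ e, f (σ e) = f e + p e) ∧ ∀ e, f (α e) = f e + p e := by
  classical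
  let sσ := Equiv.Perm.SameCycle.setoid σ
  let sα := Equiv.Perm.SameCycle.setoid α
  let sφ := Equiv.Perm.SameCycle.setoid (σ * α)
  -- `Z` consists of the boundaries of face sets. `Y` is spanned by edge and vertex functions, so
  -- its annihilator consists of the edge sets of even degree. The claim is that these agree under
  -- the dot product: the inclusion of `Z` is direct, and equality follows by counting dimensions.
  let Y := classFunctions sα ⊔ classFunctions sσ
  let Z := (classFunctions sφ).map (coboundary α)
  let D := dotProductEquiv (ZMod 2) E
  -- Faces and edges generate the same connected components as vertices and edges, so both dimension
  -- counts are corrected by the same number.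
  have hsup : sφ ⊔ sα = sσ ⊔ sα := by
    have key : ∀ σ τ : Equiv.Perm E, τ = σ * α → Equiv.Perm.SameCycle.setoid τ ≤
        Equiv.Perm.SameCycle.setoid σ ⊔ Equiv.Perm.SameCycle.setoid α := by
      rintro σ τ rfl
      set s := Equiv.Perm.SameCycle.setoid σ ⊔ Equiv.Perm.SameCycle.setoid α with hs
      have h1 : ∀ e, s ((σ * α) e) e := fun e =>
        s.trans ((le_sup_left : _ ≤ s) (⟨-1, by simp⟩ : Equiv.Perm.SameCycle σ _ (α e)))
          ((le_sup_right : _ ≤ s) (⟨-1, by simp⟩ : Equiv.Perm.SameCycle α _ e))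
      rintro a b ⟨k, rfl⟩
      have hz : ∀ (k : ℤ) (a : E), s (((σ * α) ^ k) a) a := by
        intro k
        induction k with
        | zero => intro a; exact s.refl _
        | succ n ih => intro a; rw [zpow_add_one]; exact s.trans (ih _) (h1 a)
        | pred n ih =>
          intro a
          rw [zpow_sub_one]
          refine s.trans (ih _) (s.symm ?_)
          have := h1 ((σ * α)⁻¹ a)
          rwa [← Equiv.Perm.mul_apply, mul_inv_cancel, Equiv.Perm.one_apply] at this
      exact s.symm (hz k a)
    refine le_antisymm (sup_le (key σ _ rfl) le_sup_right) (sup_le (key (σ * α) σ ?_) le_sup_right)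
    ext e
    simp [hα]
  have hY : Module.finrank (ZMod 2) Y + Nat.card (Quotient (sσ ⊔ sα)) =
      numCycles α + numCycles σ := by
    have h := Submodule.finrank_sup_add_finrank_inf_eq (classFunctions sα) (classFunctions sσ)
    rw [classFunctions_inf, finrank_classFunctions, finrank_classFunctions,
      finrank_classFunctions, sup_comm sα sσ] at h
    exact h
  have hZ : Module.finrank (ZMod 2) Z + Nat.card (Quotient (sσ ⊔ sα)) = numCycles (σ * α) := by
    have h := LinearMap.finrank_range_add_finrank_ker
      ((coboundary α).domRestrict (classFunctions sφ))
    rw [LinearMap.ker_domRestrict, LinearMap.range_domRestrict, finrank_classFunctions] at h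
    have h' : Module.finrank (ZMod 2) ((LinearMap.ker (coboundary α)).submoduleOf
        (classFunctions sφ)) = Nat.card (Quotient (sσ ⊔ sα)) := by
      have h1 := (Submodule.submoduleOfEquivOfLe (inf_le_left :
        classFunctions sφ ⊓ classFunctions sα ≤ classFunctions sφ)).finrank_eq
      have h2 : (classFunctions sφ ⊓ classFunctions sα).submoduleOf (classFunctions sφ) =
          (classFunctions sα).submoduleOf (classFunctions sφ) := by
        simp [Submodule.submoduleOf]
      rwa [h2, classFunctions_inf, finrank_classFunctions, hsup, ← ker_coboundary α] at h1
    rw [← h']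
    exact h
  have hle : Z.map D.toLinearMap ≤ Y.dualAnnihilator := by
    rintro _ ⟨_, ⟨f, hf, rfl⟩, rfl⟩
    have hf' := mem_classFunctions_sameCycle.1 hf
    rw [Submodule.dualAnnihilator_sup_eq, Submodule.mem_inf, Submodule.mem_dualAnnihilator,
      Submodule.mem_dualAnnihilator]
    have hD : ∀ g, D (coboundary α f) g = ∑ e, (f e * g e + f e * g (α e)) := by
      intro g
      have h1 : D (coboundary α f) g = ∑ e, (f e + f (α e)) * g e := rfl
      simp only [h1, add_mul, Finset.sum_add_distrib]
      congr 1
      rw [← Equiv.sum_comp α]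
      simp [hα]
    constructor
    · intro g hg
      have hg' := mem_classFunctions_sameCycle.1 hg
      refine (hD g).trans (Finset.sum_eq_zero fun e _ => ?_)
      rw [hg', CharTwo.add_self_eq_zero]
    · intro g hg
      have hg' := mem_classFunctions_sameCycle.1 hg
      refine (hD g).trans ?_
      rw [Finset.sum_add_distrib, ← Equiv.sum_comp (σ * α) fun e => f e * g e]
      simp only [hf']
      simp only [Equiv.Perm.mul_apply, hg']
      rw [CharTwo.add_self_eq_zero]
  -- With `v`, `e`, `f`, `c` vertices, edges, faces and components, the dimensions are `f - c` and
  -- `2e - (e + v - c)`. They agree exactly when `v + f = e + 2c`.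
  have heq : Z.map D.toLinearMap = Y.dualAnnihilator := by
    refine Submodule.eq_of_le_of_finrank_eq hle ?_
    have h1 := Subspace.finrank_add_finrank_dualAnnihilator_eq Y
    rw [Module.finrank_fintype_fun_eq_card, card_eq_two_mul_numCycles hα hne] at h1
    have h2 : Module.finrank (ZMod 2) (Z.map D.toLinearMap) = Module.finrank (ZMod 2) Z :=
      LinearEquiv.finrank_map_eq D Z
    rw [h2]
    change _ = _ + 2 * Nat.card (Quotient (sσ ⊔ sα)) at hplanar
    omega
  have hpY : D p ∈ Y.dualAnnihilator := by
    rw [Submodule.dualAnnihilator_sup_eq, Submodule.mem_inf, Submodule.mem_dualAnnihilator,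
      Submodule.mem_dualAnnihilator]
    constructor
    · intro g hg
      have hg' := mem_classFunctions_sameCycle.1 hg
      refine Finset.sum_involution (fun e _ => α e) (fun e _ => ?_) (fun e _ _ => hne e)
        (fun e _ => Finset.mem_univ _) (fun e _ => hα e)
      rw [hp, hg', CharTwo.add_self_eq_zero]
    · intro g hg
      exact heven g (mem_classFunctions_sameCycle.1 hg)
  rw [← heq] at hpY
  obtain ⟨_, ⟨f, hf, rfl⟩, h⟩ := hpY
  have hfp : coboundary α f = p := D.injective h
  have hf' := mem_classFunctions_sameCycle.1 hf
  have hfα : ∀ e, f (α e) = f e + p e := by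
    intro e
    rw [← hfp, coboundary_apply, ← add_assoc, CharTwo.add_self_eq_zero, zero_add]
  -- `σ e` follows `α e` around a face, and `f` is constant on faces.
  refine ⟨f, fun e => ?_, hfα⟩
  rw [← hfα, ← hf' (α e), Equiv.Perm.mul_apply, hα]

end Colouring

/-! ### Paths formed by two involutions -/

section Paths

variable {E : Type*}

/-- Follow `α` everywhere, and `ℓ` outside of `Z`. -/
def pathStep (α ℓ : E → E) (Z : Set E) (d e : E) : Prop := e = α d ∨ (d ∉ Z ∧ e = ℓ d)

/-- If `α` and `ℓ` are fixed point free involutions, a path that starts in `Z` and is followed by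
`α`, and by `ℓ` outside of `Z`, has exactly one other end in `Z`. -/
theorem exists_other_end [Finite E] {α ℓ : Equiv.Perm E} {Z : Set E}
    (hα : ∀ e, α (α e) = e) (hαne : ∀ e, α e ≠ e) (hℓ : ∀ e, ℓ (ℓ e) = e) (hℓne : ∀ e, ℓ e ≠ e)
    (hZ : ∀ e, ℓ e ∈ Z ↔ e ∈ Z) {s : E} (hs : s ∈ Z) :
    ∃ t ∈ Z, t ≠ s ∧ Relation.EqvGen (pathStep α ℓ Z) s t ∧
      ∀ u ∈ Z, Relation.EqvGen (pathStep α ℓ Z) s u → u = s ∨ u = t := by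
  classical
  -- `τ` is `ℓ` made to stop at `Z`, so its fixed points are the points of `Z`. The path is the
  -- orbit of `s` under the dihedral group generated by `α` and `τ`; since `τ s = s`, all of its
  -- points are `(g ^ k) s` for the rotation `g = α * τ`.
  let τ : Equiv.Perm E := Function.Involutive.toPerm (fun e => if e ∈ Z then e else ℓ e) (by
    intro e
    by_cases h : e ∈ Z <;> simp [h, hZ, hℓ])
  have hτ : ∀ e, τ e = if e ∈ Z then e else ℓ e := fun _ => rfl
  have hτZ : ∀ e, τ e = e ↔ e ∈ Z := by
    intro e
    by_cases h : e ∈ Z <;> simp [hτ, h, hℓne]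
  have hττ : ∀ e, τ (τ e) = e := by
    intro e
    by_cases h : e ∈ Z <;> simp [hτ, h, hZ, hℓ]
  set g : Equiv.Perm E := α * τ with hg
  have hgτ : ∀ (k : ℤ) (e : E), τ ((g ^ k) e) = (g ^ (-k)) (τ e) := by
    intro k e
    have h1 : τ * g * τ⁻¹ = g⁻¹ := by
      have h2 : τ⁻¹ = τ := Equiv.ext fun e => by rw [Equiv.Perm.inv_eq_iff_eq, hττ]
      have h3 : α⁻¹ = α := Equiv.ext fun e => by rw [Equiv.Perm.inv_eq_iff_eq, hα]
      rw [hg, mul_inv_rev, h2, h3, mul_assoc, mul_assoc]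
      congr 1
      ext e
      simp [hττ]
    have h4 : τ * g ^ k * τ⁻¹ = g ^ (-k) := by rw [← conj_zpow, h1, inv_zpow, zpow_neg]
    rw [← h4]
    simp
  have hτs : τ s = s := (hτZ s).2 hs
  have hgs : ∀ k : ℤ, τ ((g ^ k) s) = (g ^ (-k)) s := fun k => by rw [hgτ, hτs]
  have hαs : ∀ k : ℤ, α ((g ^ k) s) = (g ^ (1 - k)) s := by
    intro k
    have : ∀ e, α e = g (τ e) := fun e => by rw [hg, Equiv.Perm.mul_apply, hττ]
    rw [this, hgs, sub_eq_add_neg, zpow_one_add]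
    rfl
  have hclass : ∀ u, Relation.EqvGen (pathStep α ℓ Z) s u → ∃ k : ℤ, u = (g ^ k) s := by
    have key : ∀ u v, Relation.EqvGen (pathStep α ℓ Z) u v →
        ((∃ k : ℤ, u = (g ^ k) s) ↔ ∃ k : ℤ, v = (g ^ k) s) := by
      intro u v huv
      induction huv with
      | rel u v h =>
        rcases h with rfl | ⟨hu, rfl⟩
        · constructor
          · rintro ⟨k, rfl⟩
            exact ⟨_, hαs k⟩
          · rintro ⟨k, hk⟩
            exact ⟨1 - k, by rw [← hαs, ← hk, hα]⟩
        · have h : ℓ u = τ u := by simp [hτ, hu]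
          rw [h]
          constructor
          · rintro ⟨k, rfl⟩
            exact ⟨_, hgs k⟩
          · rintro ⟨k, hk⟩
            exact ⟨-k, by rw [← hgs, ← hk, hττ]⟩
      | refl u => exact Iff.rfl
      | symm u v _ ih => exact ih.symm
      | trans u v w _ _ ih₁ ih₂ => exact ih₁.trans ih₂
    exact fun u hu => (key s u hu).1 ⟨0, by simp⟩
  have hconn : ∀ k : ℕ, Relation.EqvGen (pathStep α ℓ Z) s ((g ^ k) s) := by
    intro k
    induction k with
    | zero => exact Relation.EqvGen.refl s
    | succ k ih =>
      rw [pow_succ', Equiv.Perm.mul_apply, hg, Equiv.Perm.mul_apply]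
      refine ih.trans _ _ _ ?_
      rw [← hg]
      refine Relation.EqvGen.trans _ (τ ((g ^ k) s)) _ ?_ (Relation.EqvGen.rel _ _ (Or.inl rfl))
      by_cases h : (g ^ k) s ∈ Z
      · rw [(hτZ _).2 h]
        exact Relation.EqvGen.refl _
      · exact Relation.EqvGen.rel _ _ (Or.inr ⟨h, by simp [hτ, h]⟩)
  -- `τ` acts on exponents by `k ↦ -k`, so the points in `Z` are those with `2k` divisible by the
  -- period: exponent 0 and half the period.
  have hmem : ∀ k : ℤ, (g ^ k) s ∈ Z ↔ (g ^ (2 * k)) s = s := by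
    intro k
    rw [← hτZ, hgs, zpow_neg, Equiv.Perm.inv_eq_iff_eq, two_mul, zpow_add, Equiv.Perm.mul_apply,
      eq_comm]
  set N := Function.minimalPeriod g s with hN
  have hzp : ∀ k : ℤ, (g ^ k) s = s ↔ (N : ℤ) ∣ k := by
    intro k
    rw [hN]
    exact MulAction.zpow_smul_eq_iff_minimalPeriod_dvd (a := g) (b := s) (n := k)
  -- `α` acts on exponents by `k ↦ 1 - k`. For an odd period `2j + 1` this would fix `j + 1`, but
  -- `α` has no fixed points.
  have hNeven : Even N := by
    by_contra hodd
    obtain ⟨j, hj⟩ := Nat.not_even_iff_odd.1 hodd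
    refine hαne ((g ^ ((j : ℤ) + 1)) s) ?_
    rw [hαs]
    have h := (hzp (N : ℤ)).2 dvd_rfl
    have h2 : ((j : ℤ) + 1) = (1 - ((j : ℤ) + 1)) + N := by rw [hj]; push_cast; ring
    conv_rhs => rw [h2, zpow_add, Equiv.Perm.mul_apply, h]
  obtain ⟨j, hj⟩ := hNeven
  have hNpos : 0 < N := Function.IsPeriodicPt.minimalPeriod_pos (n := orderOf g) (orderOf_pos g) (by
    have : (g ^ orderOf g) s = s := by rw [pow_orderOf_eq_one]; rfl
    rwa [Equiv.Perm.coe_pow] at this)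
  refine ⟨(g ^ j) s, ?_, ?_, hconn j, ?_⟩
  · have := (hmem j).2 ((hzp _).2 ⟨1, by rw [hj]; push_cast; ring⟩)
    rwa [zpow_natCast] at this
  · intro h
    have := (hzp j).1 (by rwa [zpow_natCast])
    have := Int.le_of_dvd (by omega) this
    omega
  · intro u hu hsu
    obtain ⟨k, rfl⟩ := hclass u hsu
    obtain ⟨c, hc⟩ := (hzp _).1 ((hmem k).1 hu)
    have hk : k = j * c := by
      rw [hj] at hc
      push_cast at hc
      linarith
    rcases Int.even_or_odd' c with ⟨b, rfl | rfl⟩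
    · left
      rw [hzp]
      exact ⟨b, by rw [hk, hj]; push_cast; ring⟩
    · right
      have : k = j + N * b := by rw [hk, hj]; push_cast; ring
      rw [this, zpow_add, Equiv.Perm.mul_apply, (hzp _).2 ⟨b, rfl⟩, zpow_natCast]

end Paths

/-! ### Noncrossing paths in planar maps -/

section Rotation

/-- `φ` changes by `p` from one point of a boundary circle to the next one, where the change at a
point happens just after it, or just before it. -/
def ChangesBy {N : ℕ} (φ p : Fin N → ZMod 2) : Prop :=
  (∀ j, φ (finRotate N j) = φ j + p j) ∨ ∀ j, φ (finRotate N j) = φ j + p (finRotate N j)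

theorem finRotate_mk {N k : ℕ} (hk : k + 1 < N) :
    finRotate N ⟨k, by omega⟩ = ⟨k + 1, hk⟩ := by
  obtain ⟨N, rfl⟩ : ∃ M, N = M + 1 := ⟨N - 1, by omega⟩
  exact finRotate_of_lt (by omega)

/-- Telescoping gives a half-open interval, on a side that depends on whether the change comes after
or before the point. Since `p` vanishes at both ends, either case reduces to the open interval. -/
theorem ChangesBy.apply_eq_add_sum {N : ℕ} {φ p : Fin N → ZMod 2} (h : ChangesBy φ p)
    {a b : Fin N} (hab : a ≤ b) (ha : p a = 0) (hb : p b = 0) :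
    φ b = φ a + ∑ j ∈ Finset.Ioo a b, p j := by
  rcases h with h | h
  · have key : ∀ k (hk : k < N), a.1 ≤ k → φ ⟨k, hk⟩ = φ a + ∑ j ∈ Finset.Ico a ⟨k, hk⟩, p j := by
      intro k hk hak
      induction k, hak using Nat.le_induction with
      | base => simp
      | succ k hak ih =>
        have hins : Finset.Ico a ⟨k + 1, hk⟩ =
            insert ⟨k, by omega⟩ (Finset.Ico a ⟨k, by omega⟩) := by
          ext j
          simp only [Finset.mem_insert, Finset.mem_Ico, Fin.le_def, Fin.lt_def, Fin.ext_iff]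
          omega
        rw [hins, Finset.sum_insert (by simp), ← finRotate_mk hk, h, ih (by omega), add_assoc,
          add_comm (p _)]
    rw [key b.1 b.2 hab]
    congr 1
    refine (Finset.sum_subset Finset.Ioo_subset_Ico_self fun j hj hj' => ?_).symm
    have : j = a := by
      simp only [Finset.mem_Ico, Finset.mem_Ioo, Fin.le_def, Fin.lt_def, Fin.ext_iff] at *
      omega
    rw [this, ha]
  · have key : ∀ k (hk : k < N), a.1 ≤ k → φ ⟨k, hk⟩ = φ a + ∑ j ∈ Finset.Ioc a ⟨k, hk⟩, p j := by
      intro k hk hak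
      induction k, hak using Nat.le_induction with
      | base => simp
      | succ k hak ih =>
        have hins : Finset.Ioc a ⟨k + 1, hk⟩ =
            insert ⟨k + 1, hk⟩ (Finset.Ioc a ⟨k, by omega⟩) := by
          ext j
          simp only [Finset.mem_insert, Finset.mem_Ioc, Fin.le_def, Fin.lt_def, Fin.ext_iff]
          omega
        rw [hins, Finset.sum_insert (by simp), ← finRotate_mk hk, h, ih (by omega), add_assoc,
          add_comm (p _)]
    rw [key b.1 b.2 hab]
    congr 1
    refine (Finset.sum_subset Finset.Ioo_subset_Ioc_self fun j hj hj' => ?_).symm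
    have : j = b := by
      simp only [Finset.mem_Ioc, Finset.mem_Ioo, Fin.le_def, Fin.lt_def, Fin.ext_iff] at *
      omega
    rw [this, hb]

/-- A planar matching does not cross the arcs `p` of the same matching. -/
theorem ChangesBy.apply_perm {n : ℕ} {φ p : Fin (2 * n) → ZMod 2} (h : ChangesBy φ p)
    (m : NCMatching n) (hp : ∀ a, p (m.perm a) = p a) {a : Fin (2 * n)} (ha : p a = 0) :
    φ (m.perm a) = φ a := by
  have key : ∀ a, a < m.perm a → p a = 0 → φ (m.perm a) = φ a := by
    intro a hlt ha
    -- By noncrossing, `m` pairs off the points strictly between `a` and `m.perm a`, and the two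
    -- members of a pair contribute equally, so the sum vanishes mod 2.
    rw [h.apply_eq_add_sum hlt.le ha (by rw [hp, ha]), Finset.sum_involution
      (fun j _ => m.perm j) (fun j _ => by rw [hp, CharTwo.add_self_eq_zero])
      (fun j _ _ => m.perm_ne j) ?_ (fun j _ => m.perm_perm j), add_zero]
    intro j hj
    rw [Finset.mem_Ioo] at hj ⊢
    constructor
    · by_contra hlt'
      rcases (not_lt.1 hlt').lt_or_eq with h' | h'
      · refine m.noncrossing (m.perm j) a ⟨h', ?_, ?_⟩
        · rw [m.perm_perm]; exact hj.1
        · rw [m.perm_perm]; exact hj.2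
      · rw [← h', m.perm_perm] at hj
        exact lt_irrefl _ hj.2
    · by_contra hlt'
      rcases (not_lt.1 hlt').lt_or_eq with h' | h'
      · exact m.noncrossing a j ⟨hj.1, hj.2, h'⟩
      · exact hj.1.ne (m.perm.injective h')
  rcases lt_trichotomy a (m.perm a) with h' | h' | h'
  · exact key a h' ha
  · rw [← h']
  · have := key (m.perm a) (by rwa [m.perm_perm]) (by rw [hp, ha])
    rw [m.perm_perm] at this
    exact this.symm

/-- A matching `m` whose arcs are not separated by an arc is noncrossing. -/
theorem ChangesBy.not_crossing {N : ℕ} {φ p : Fin N → ZMod 2} (h : ChangesBy φ p)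
    {a b c d : Fin N} (hp : ∀ j, p j = if j = a ∨ j = c then 1 else 0) (hφ : φ b = φ d) :
    ¬ (a < b ∧ b < c ∧ c < d) := by
  rintro ⟨hab, hbc, hcd⟩
  have h0 := h.apply_eq_add_sum (hbc.trans hcd).le
    (by rw [hp, if_neg]; rintro (h | h); exacts [hab.ne h.symm, hbc.ne h])
    (by rw [hp, if_neg]; rintro (h | h); exacts [((hab.trans hbc).trans hcd).ne h.symm, hcd.ne h.symm])
  -- Of `a` and `c`, only `c` lies strictly between `b` and `d`, so the colour would change exactly
  -- once.
  rw [Finset.sum_eq_single_of_mem c (Finset.mem_Ioo.2 ⟨hbc, hcd⟩), hp, if_pos (Or.inr rfl), hφ,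
    left_eq_add] at h0
  · exact one_ne_zero h0
  · intro j hj hjc
    rw [hp, if_neg]
    rintro (rfl | rfl)
    · exact absurd hab (not_lt.2 (Finset.mem_Ioo.1 hj).1.le)
    · exact hjc rfl

end Rotation

section Separation

variable {E : Type*} [Finite E] {σ α ℓ : Equiv.Perm E} {Z : Set E}

/-- On a map of genus zero, the path from `s` to `t` separates the sphere, and the paths disjoint
from it do not cross it. -/
theorem exists_path_colouring (hα : ∀ e, α (α e) = e) (hαne : ∀ e, α e ≠ e)
    (hℓ : ∀ e, ℓ (ℓ e) = e) (hℓne : ∀ e, ℓ e ≠ e) (hZ : ∀ e, ℓ e ∈ Z ↔ e ∈ Z)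
    (hplanar : numCycles σ + numCycles (σ * α) = numCycles α + 2 * Nat.card (Quotient
      (Equiv.Perm.SameCycle.setoid σ ⊔ Equiv.Perm.SameCycle.setoid α)))
    (hℓσ : ∀ h : E → ZMod 2, (∀ e, h (σ e) = h e) → ∀ e, h (ℓ e) = h e)
    (hZσ : ∀ h : E → ZMod 2, (∀ e, h (σ e) = h e) → ∀ x ∈ Z, ∀ y ∈ Z, h x = h y)
    (hcross : ∀ f p : E → ZMod 2, (∀ e, f (σ e) = f e + p e) → (∀ e, e ∉ Z → p (ℓ e) = p e) →
      ∀ e, e ∉ Z → p e = 0 → f (ℓ e) = f e)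
    {s t : E} (hs : s ∈ Z) (ht : t ∈ Z) (hts : t ≠ s)
    (hst : Relation.EqvGen (pathStep α ℓ Z) s t)
    (huniq : ∀ u ∈ Z, Relation.EqvGen (pathStep α ℓ Z) s u → u = s ∨ u = t) :
    ∃ f p : E → ZMod 2, (∀ e, f (σ e) = f e + p e) ∧
      (∀ z ∈ Z, (z = s ∨ z = t → p z = 1) ∧ (¬ (z = s ∨ z = t) → p z = 0)) ∧
      ∀ u v, ¬ Relation.EqvGen (pathStep α ℓ Z) s u → Relation.EqvGen (pathStep α ℓ Z) u v →
        f u = f v := by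
  classical
  have := Fintype.ofFinite E
  -- The indicator of the path through `s`.
  let p : E → ZMod 2 := fun e => if Relation.EqvGen (pathStep α ℓ Z) s e then 1 else 0
  have hp : ∀ u v, Relation.EqvGen (pathStep α ℓ Z) u v → p v = p u := by
    intro u v huv
    have : Relation.EqvGen (pathStep α ℓ Z) s v ↔ Relation.EqvGen (pathStep α ℓ Z) s u :=
      ⟨fun h => h.trans _ _ _ (huv.symm _ _), fun h => h.trans _ _ _ huv⟩
    simp only [p, this]
  have hpα : ∀ e, p (α e) = p e := fun e => hp _ _ (.rel _ _ (Or.inl rfl))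
  have hpℓ : ∀ e, e ∉ Z → p (ℓ e) = p e := fun e he => hp _ _ (.rel _ _ (Or.inr ⟨he, rfl⟩))
  have hpZ : ∀ z ∈ Z, (z = s ∨ z = t → p z = 1) ∧ (¬ (z = s ∨ z = t) → p z = 0) := by
    intro z hz
    constructor
    · rintro (rfl | rfl)
      · exact if_pos (.refl _)
      · exact if_pos hst
    · exact fun h => if_neg fun h' => h (huniq z hz h')
  -- Even degree at every vertex: away from `Z` an end `e` of the path is cancelled by `ℓ e`, which
  -- belongs to the same vertex by `hℓσ`. In `Z` the path has only the ends `s` and `t`, which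
  -- cancel each other by `hZσ`.
  obtain ⟨f, hf, hfα⟩ := exists_face_colouring hα hαne hplanar p hpα (by
    intro h hh
    have hmem : ∀ e, e ∈ Z → p e * h e ≠ 0 → e = s ∨ e = t := by
      intro e he hne
      by_contra hst'
      exact hne (by rw [(hpZ e he).2 hst', zero_mul])
    rw [← Finset.sum_filter_ne_zero]
    refine Finset.sum_involution
      (fun e _ => if e ∈ Z then (if e = s then t else s) else ℓ e) ?_ ?_ ?_ ?_
    · intro e he
      have he' := (Finset.mem_filter.1 he).2
      by_cases hz : e ∈ Z
      · rcases hmem e hz he' with rfl | rfl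
        · simp only [hz, if_true]
          rw [(hpZ e hz).1 (Or.inl rfl), (hpZ t ht).1 (Or.inr rfl), hZσ h hh e hz t ht,
            CharTwo.add_self_eq_zero]
        · simp only [hz, if_true, hts, if_false]
          rw [(hpZ e hz).1 (Or.inr rfl), (hpZ s hs).1 (Or.inl rfl), hZσ h hh e hz s hs,
            CharTwo.add_self_eq_zero]
      · simp only [hz, if_false]
        rw [hpℓ e hz, hℓσ h hh, CharTwo.add_self_eq_zero]
    · intro e he he'
      by_cases hz : e ∈ Z
      · rcases hmem e hz he' with rfl | rfl
        · simpa [hz] using hts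
        · simpa [hz, hts] using hts.symm
      · simpa [hz] using hℓne e
    · intro e he
      have he' := (Finset.mem_filter.1 he).2
      refine Finset.mem_filter.2 ⟨Finset.mem_univ _, ?_⟩
      by_cases hz : e ∈ Z
      · rcases hmem e hz he' with rfl | rfl
        · simp only [hz, if_true]
          rwa [(hpZ t ht).1 (Or.inr rfl), hZσ h hh t ht e hz, ← (hpZ e hz).1 (Or.inl rfl)]
        · simp only [hz, if_true, hts, if_false]
          rwa [(hpZ s hs).1 (Or.inl rfl), hZσ h hh s hs e hz, ← (hpZ e hz).1 (Or.inr rfl)]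
      · simp only [hz, if_false]
        rwa [hpℓ e hz, hℓσ h hh]
    · intro e he
      have he' := (Finset.mem_filter.1 he).2
      by_cases hz : e ∈ Z
      · rcases hmem e hz he' with rfl | rfl
        · simp [hz, ht, hts]
        · simp [hz, hs, hts]
      · simp [hz, hZ, hℓ])
  refine ⟨f, p, hf, hpZ, fun u v hu huv => ?_⟩
  -- Along a path disjoint from the first one `p` vanishes, so the colour changes neither along an
  -- edge nor, by `hcross`, on passing through a vertex.
  have hconst : ∀ u v, Relation.EqvGen (pathStep α ℓ Z) u v → p u = 0 → f u = f v := by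
    intro u v huv
    induction huv with
    | rel u v h =>
      intro hpu
      rcases h with rfl | ⟨hu, rfl⟩
      · rw [hfα, hpu, add_zero]
      · rw [hcross f p hf hpℓ u hu hpu]
    | refl u => exact fun _ => rfl
    | symm u v h ih => exact fun hv => (ih (by rw [← hp _ _ h, hv])).symm
    | trans u v w h₁ h₂ ih₁ ih₂ =>
      exact fun hu => (ih₁ hu).trans (ih₂ (by rw [hp _ _ h₁, hu]))
  exact hconst u v huv (if_neg hu)

end Separation

/-! ### Induced matchings of planar tangle diagrams -/

section InducedMatching

/-- The paths outside a vertex of a planar map form a planar matching of the points at this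
vertex. -/
theorem exists_ncMatching {E : Type*} [Finite E] {σ α ℓ : Equiv.Perm E} {N : ℕ}
    {v : Fin (2 * N) → E} (hv : Function.Injective v)
    (hα : ∀ e, α (α e) = e) (hαne : ∀ e, α e ≠ e)
    (hℓ : ∀ e, ℓ (ℓ e) = e) (hℓne : ∀ e, ℓ e ≠ e)
    (hZ : ∀ e, ℓ e ∈ Set.range v ↔ e ∈ Set.range v)
    (hplanar : numCycles σ + numCycles (σ * α) = numCycles α + 2 * Nat.card (Quotient
      (Equiv.Perm.SameCycle.setoid σ ⊔ Equiv.Perm.SameCycle.setoid α)))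
    (hℓσ : ∀ h : E → ZMod 2, (∀ e, h (σ e) = h e) → ∀ e, h (ℓ e) = h e)
    (hσv : (∀ j, σ (v j) = v (finRotate _ j)) ∨ ∀ j, σ (v (finRotate _ j)) = v j)
    (hcross : ∀ f p : E → ZMod 2, (∀ e, f (σ e) = f e + p e) →
      (∀ e, e ∉ Set.range v → p (ℓ e) = p e) →
      ∀ e, e ∉ Set.range v → p e = 0 → f (ℓ e) = f e) :
    ∃ m : NCMatching N, ∀ a, Relation.EqvGen (pathStep α ℓ (Set.range v)) (v a) (v (m.perm a)) := by
  -- The points `v j` lie on one cycle of the rotation, that is, at one vertex.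
  have hZσ : ∀ h : E → ZMod 2, (∀ e, h (σ e) = h e) →
      ∀ x ∈ Set.range v, ∀ y ∈ Set.range v, h x = h y := by
    intro h hh
    have hrot : ∀ j, h (v (finRotate _ j)) = h (v j) := by
      rcases hσv with hσv | hσv
      · exact fun j => by rw [← hσv, hh]
      · exact fun j => by rw [← hh, hσv]
    have key : ∀ k (hk : k < 2 * N), h (v ⟨k, hk⟩) = h (v ⟨0, by omega⟩) := by
      intro k
      induction k with
      | zero => exact fun _ => rfl
      | succ k ih => exact fun hk => by rw [← finRotate_mk hk, hrot, ih]
    rintro _ ⟨a, rfl⟩ _ ⟨b, rfl⟩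
    rw [key a.1 a.2, key b.1 b.2]
  have hex : ∀ a, ∃ b, b ≠ a ∧ Relation.EqvGen (pathStep α ℓ (Set.range v)) (v a) (v b) ∧
      ∀ c, Relation.EqvGen (pathStep α ℓ (Set.range v)) (v a) (v c) → c = a ∨ c = b := by
    intro a
    obtain ⟨_, ⟨b, rfl⟩, h1, h2, h3⟩ := exists_other_end hα hαne hℓ hℓne hZ (Set.mem_range_self a)
    exact ⟨b, fun h => h1 (h ▸ rfl), h2, fun c hc => (h3 _ (Set.mem_range_self c) hc).imp
      (fun h => hv h) (fun h => hv h)⟩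
  choose m hmne hm huniq using hex
  have hmm : ∀ a, m (m a) = a := fun a =>
    ((huniq (m a) a ((hm a).symm _ _)).resolve_left fun h => hmne a h.symm).symm
  refine ⟨⟨Function.Involutive.toPerm m hmm, hmm, hmne, fun a b hab => ?_⟩, hm⟩
  change a < b ∧ b < m a ∧ m a < m b at hab
  -- Suppose that two arcs cross, and colour the faces by the arc from `a` to `m a`.
  obtain ⟨f, p, hf, hp, hconst⟩ := exists_path_colouring hα hαne hℓ hℓne hZ hplanar hℓσ hZσ hcross
    (Set.mem_range_self a) (Set.mem_range_self (m a)) (fun h => hmne a (hv h)) (hm a) (by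
      rintro _ ⟨c, rfl⟩ hc
      exact (huniq a c hc).imp (congrArg v) (congrArg v))
  -- The rotation follows the numbering of the points at an inside disc and reverses it at the
  -- outermost one; these are the two cases of `ChangesBy`.
  have hturn : ChangesBy (fun j => f (v j)) fun j => p (v j) := by
    rcases hσv with hσv | hσv
    · exact Or.inl fun j => by beta_reduce; rw [← hσv, hf]
    · exact Or.inr fun j => by
        beta_reduce
        rw [← hσv j, hf, add_assoc, CharTwo.add_self_eq_zero, add_zero]
  refine hturn.not_crossing (a := a) (c := m a) (fun j => ?_) (hconst (v b) (v (m b)) ?_ (hm b)) hab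
  · split_ifs with h
    · exact (hp _ (Set.mem_range_self j)).1 (h.imp (congrArg v) (congrArg v))
    · exact (hp _ (Set.mem_range_self j)).2 fun h' => h (h'.imp (fun h => hv h) (fun h => hv h))
  · intro hc
    rcases huniq a b hc with rfl | rfl
    · exact lt_irrefl _ hab.1
    · exact lt_irrefl _ hab.2.1

end InducedMatching

/-! ### Strands of a filled diagram and their ends -/

namespace Filling

section Link

variable {ι : Type*} {n : ι → ℕ} {n₀ : ℕ} {P : ArcDiagram n n₀} (F : Filling P)

theorem link_inl (p : P.Pt) : F.link (Sum.inl p) = Sum.inl (P.join p) := rfl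

theorem link_innerEnd (i : ι) (a : Fin (2 * n i)) :
    F.link (innerEnd i a) = innerEnd i ((F.inner i).perm a) := rfl

theorem link_outerEnd (a : Fin (2 * n₀)) : F.link (outerEnd a) = outerEnd (F.outer.perm a) := rfl

theorem link_link (e : Ends P.Pt n n₀) : F.link (F.link e) = e := by
  rcases e with p | ⟨i, a⟩ | a
  · rw [link_inl, link_inl, P.join_join]
  · rw [link_innerEnd, link_innerEnd, (F.inner i).perm_perm]
  · rw [link_outerEnd, link_outerEnd, F.outer.perm_perm]

theorem innerEnd_injective {K : Type} (i : ι) :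
    Function.Injective (innerEnd i : Fin (2 * n i) → Ends K n n₀) := by
  intro a b h
  simpa [innerEnd] using h

theorem outerEnd_injective {K : Type} :
    Function.Injective (outerEnd : Fin (2 * n₀) → Ends K n n₀) := by
  intro a b h
  simpa [outerEnd] using h

theorem link_ne (e : Ends P.Pt n n₀) : F.link e ≠ e := by
  rcases e with p | ⟨i, a⟩ | a
  · exact fun h => P.join_ne p (Sum.inl_injective h)
  · exact fun h => (F.inner i).perm_ne a (innerEnd_injective i h)
  · exact fun h => F.outer.perm_ne a (outerEnd_injective h)

theorem link_mem_discEnds (a : Option ι) (e : Ends P.Pt n n₀) :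
    F.link e ∈ discEnds a ↔ e ∈ discEnds a := by
  have key : ∀ e, e ∈ discEnds a → F.link e ∈ discEnds a := by
    cases a with
    | none =>
      rintro _ ⟨b, rfl⟩
      exact ⟨_, rfl⟩
    | some i =>
      rintro _ ⟨b, rfl⟩
      exact ⟨_, rfl⟩
  exact ⟨fun h => by simpa [link_link] using key _ h, key e⟩

/-- An arc through `s` off a disc has exactly two ends on the disc. -/
theorem eq_or_eq_of_connectedOff [Finite ι] {a : Option ι} {s t u : Ends P.Pt n n₀}
    (hs : s ∈ discEnds a) (ht : t ∈ discEnds a) (hu : u ∈ discEnds a) (hts : t ≠ s)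
    (hst : F.ConnectedOff a s t) (hsu : F.ConnectedOff a s u) : u = s ∨ u = t := by
  obtain ⟨w, hw, hws, hsw, huniq⟩ := exists_other_end P.edge_edge P.edge_ne F.link_link F.link_ne
    (F.link_mem_discEnds a) hs
  have h1 := (huniq t ht hst).resolve_left hts
  rw [h1]
  exact huniq u hu hsu

end Link

end Filling

/-! ### Planarity of the arcs in a resolved tangle diagram -/

namespace OrientedTangleDiagram

variable {ι : Type*} {n : ι → ℕ} {n₀ : ℕ} (T : OrientedTangleDiagram n n₀)
  {ρ : T.X → Fin 2} (F : Filling (T.resolve ρ))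

theorem rotation_crossing (x : T.X) (k : ZMod 4) :
    T.rotation (Sum.inl (Sum.inl (x, k))) = Sum.inl (Sum.inl (x, k + 1)) := rfl

theorem rotation_pt (p : T.Pt) :
    T.rotation (Sum.inl (Sum.inr p)) = Sum.inl (Sum.inr (T.join p)) := rfl

theorem rotation_innerEnd (i : ι) (a : Fin (2 * n i)) :
    T.rotation (innerEnd i a) = innerEnd i (finRotate _ a) := rfl

theorem rotation_outerEnd (a : Fin (2 * n₀)) :
    T.rotation (outerEnd (finRotate _ a)) = outerEnd a := by
  change outerEnd ((finRotate _).symm (finRotate _ a)) = _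
  rw [Equiv.symm_apply_apply]

/-- The continuation at the segment ends of a resolution. -/
def resolvedLink : Equiv.Perm (Ends ((T.X × ZMod 4) ⊕ T.Pt) n n₀) := F.link

theorem link_crossing (x : T.X) (k : ZMod 4) :
    T.resolvedLink F (Sum.inl (Sum.inl (x, k))) =
      Sum.inl (Sum.inl (x, (if ρ x = 0 then 1 else 3) - k)) := rfl

theorem link_pt (p : T.Pt) : T.resolvedLink F (Sum.inl (Sum.inr p)) = Sum.inl (Sum.inr (T.join p)) := rfl

/-- Paths that follow a filling do not cross at the vertices. -/
theorem apply_link_eq_of_potential {Z : Set (Ends ((T.X × ZMod 4) ⊕ T.Pt) n n₀)}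
    (hZ : ∀ a, (∃ e ∈ discEnds a, e ∈ Z) → discEnds a ⊆ Z)
    {f p : Ends ((T.X × ZMod 4) ⊕ T.Pt) n n₀ → ZMod 2}
    (hf : ∀ e, f (T.rotation e) = f e + p e) (hp : ∀ e, e ∉ Z → p (T.resolvedLink F e) = p e)
    {e : Ends ((T.X × ZMod 4) ⊕ T.Pt) n n₀} (he : e ∉ Z) (hpe : p e = 0) : f (T.resolvedLink F e) = f e := by
  have hnot : ∀ a, e ∈ discEnds a → ∀ e' ∈ discEnds a, e' ∉ Z :=
    fun a hea e' he' hZ' => he (hZ a ⟨e', he', hZ'⟩ hea)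
  rcases e with (⟨x, k⟩ | c) | ⟨i, a⟩ | a
  · have hadj : ∀ ε k : ZMod 4, ε = 1 ∨ ε = 3 → ε - k = k + 1 ∨ (ε - k) + 1 = k := by decide
    have hpe' := hp _ he
    rw [hpe, link_crossing] at hpe'
    rw [link_crossing]
    rcases hadj (if ρ x = 0 then 1 else 3) k (by split_ifs <;> simp) with h | h
    · rw [h, ← rotation_crossing, hf, hpe, add_zero]
    · have := hf (Sum.inl (Sum.inl (x, (if ρ x = 0 then 1 else 3) - k)))
      rw [rotation_crossing, h, hpe', add_zero] at this
      exact this.symm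
  · rw [link_pt, ← rotation_pt, hf, hpe, add_zero]
  · have hc : ChangesBy (fun a => f (innerEnd i a)) fun a => p (innerEnd i a) :=
      Or.inl fun a => by beta_reduce; rw [← rotation_innerEnd, hf]
    refine hc.apply_perm (F.inner i) (fun b => ?_) hpe
    exact hp (innerEnd i b) (hnot (some i) ⟨a, rfl⟩ _ ⟨b, rfl⟩)
  · have hc : ChangesBy (fun a => f (outerEnd a)) fun a => p (outerEnd a) :=
      Or.inr fun a => by
        beta_reduce
        rw [← T.rotation_outerEnd a, hf, add_assoc, CharTwo.add_self_eq_zero, add_zero]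
    refine hc.apply_perm F.outer (fun b => ?_) hpe
    exact hp (outerEnd b) (hnot none ⟨a, rfl⟩ _ ⟨b, rfl⟩)

/-- The continuation of a strand stays at the same vertex: this is the noncrossing statement for an
empty set of edges. -/
theorem apply_link_eq_of_invariant {h : Ends ((T.X × ZMod 4) ⊕ T.Pt) n n₀ → ZMod 2}
    (hh : ∀ e, h (T.rotation e) = h e) (e : Ends ((T.X × ZMod 4) ⊕ T.Pt) n n₀) :
    h (T.resolvedLink F e) = h e :=
  T.apply_link_eq_of_potential F (Z := ∅) (p := fun _ => 0) (by simp) (by simpa using hh)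
    (fun _ _ => rfl) (by simp) rfl

theorem discEnds_subset {a b : Option ι}
    (h : ∃ e ∈ discEnds (K := (T.X × ZMod 4) ⊕ T.Pt) (n := n) (n₀ := n₀) a, e ∈ discEnds b) :
    discEnds (K := (T.X × ZMod 4) ⊕ T.Pt) (n := n) (n₀ := n₀) a ⊆ discEnds b := by
  obtain ⟨e, ha, hb⟩ := h
  have : a = b := by
    cases a <;> cases b <;> obtain ⟨x, rfl⟩ := ha <;> obtain ⟨y, hy⟩ := hb
    · rfl
    · simp at hy
    · simp at hy
    · simp only [Sum.inr.injEq, Sum.inl.injEq, Sigma.mk.injEq] at hy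
      rw [hy.1]
  rw [this]

/-- Genus zero is assumed for the diagram with its crossings as four-valent vertices. The paths of a
resolution run in that same map and turn at the crossings without crossing each other, so no Euler
count for the resolution itself is needed. -/
theorem exists_matching_outer [Finite ι] (hT : T.IsPlanar) :
    ∃ m : NCMatching n₀, ∀ a, F.ConnectedOff none (outerEnd a) (outerEnd (m.perm a)) :=
  exists_ncMatching (σ := T.rotation) (α := T.edge) (ℓ := T.resolvedLink F) Filling.outerEnd_injective
    T.edge_edge T.edge_ne F.link_link F.link_ne (F.link_mem_discEnds none) hT
    (fun _ hh => T.apply_link_eq_of_invariant F hh) (Or.inr T.rotation_outerEnd)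
    (fun _ _ hf hp _ => T.apply_link_eq_of_potential F
      (fun _ => T.discEnds_subset (b := none)) hf hp)

theorem exists_matching_inner [Finite ι] (hT : T.IsPlanar) (i : ι) :
    ∃ m : NCMatching (n i), ∀ a,
      F.ConnectedOff (some i) (innerEnd i a) (innerEnd i (m.perm a)) :=
  exists_ncMatching (σ := T.rotation) (α := T.edge) (ℓ := T.resolvedLink F) (Filling.innerEnd_injective i)
    T.edge_edge T.edge_ne F.link_link F.link_ne (F.link_mem_discEnds (some i)) hT
    (fun _ hh => T.apply_link_eq_of_invariant F hh) (Or.inl (T.rotation_innerEnd i))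
    (fun _ _ hf hp _ => T.apply_link_eq_of_potential F
      (fun _ => T.discEnds_subset (b := some i)) hf hp)

end OrientedTangleDiagram

/-! ### Gluing of connectivity relations -/

section GlueRel

variable {D E E' G : Type*}

/-- The union of relations on `E` and on `E'`, where `s a` is related to `s' a`. -/
def glueRel (r : E → E → Prop) (r' : E' → E' → Prop) (s : G → E) (s' : G → E') :
    E ⊕ E' → E ⊕ E' → Prop
  | Sum.inl d, Sum.inl e => r d e
  | Sum.inr t, Sum.inr t' => r' t t'
  | Sum.inl d, Sum.inr t => ∃ a, d = s a ∧ t = s' a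
  | Sum.inr t, Sum.inl d => ∃ a, d = s a ∧ t = s' a

theorem glueRel_swap {r : E → E → Prop} {r' : E' → E' → Prop} {s : G → E} {s' : G → E'}
    (x y : E ⊕ E') : glueRel r' r s' s x.swap y.swap ↔ glueRel r r' s s' x y := by
  rcases x with d | t <;> rcases y with e | t' <;> simp [glueRel, and_comm]

variable {r : E → E → Prop} {r' : E' → E' → Prop} {s : G → E} {s' : G → E'} {R : E → E → Prop}

/-- Connectivity from a point of `E` in a glued object, when `R` is the connectivity in `E` together
with the connections through `E'`. -/
theorem eqvGen_glueRel (hR : Equivalence R) (hr : ∀ d e, r d e → R d e)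
    (hs : ∀ a b, Relation.EqvGen r' (s' a) (s' b) → R (s a) (s b)) {d : E} {y : E ⊕ E'}
    (h : Relation.EqvGen (glueRel r r' s s') (Sum.inl d) y) :
    Sum.elim (R d) (fun t => ∃ a, R d (s a) ∧ Relation.EqvGen r' (s' a) t) y := by
  have key : ∀ x y, Relation.EqvGen (glueRel r r' s s') x y →
      (Sum.elim (R d) (fun t => ∃ a, R d (s a) ∧ Relation.EqvGen r' (s' a) t) x ↔
        Sum.elim (R d) (fun t => ∃ a, R d (s a) ∧ Relation.EqvGen r' (s' a) t) y) := by
    have hglue : ∀ a, R d (s a) ↔ ∃ b, R d (s b) ∧ Relation.EqvGen r' (s' b) (s' a) := fun a =>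
      ⟨fun h => ⟨a, h, .refl _⟩, fun ⟨b, h, h'⟩ => hR.trans h (hs b a h')⟩
    intro x y h
    induction h with
    | rel x y h =>
      rcases x with x | x <;> rcases y with y | y
      · exact ⟨fun h' => hR.trans h' (hr _ _ h), fun h' => hR.trans h' (hR.symm (hr _ _ h))⟩
      · obtain ⟨a, rfl, rfl⟩ := h
        exact hglue a
      · obtain ⟨a, rfl, rfl⟩ := h
        exact (hglue a).symm
      · exact exists_congr fun a => and_congr_right fun _ =>
          ⟨fun h' => h'.trans _ _ _ (.rel _ _ h), fun h' => h'.trans _ _ _ (.symm _ _ (.rel _ _ h))⟩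
    | refl x => exact Iff.rfl
    | symm x y _ ih => exact ih.symm
    | trans x y z _ _ ih₁ ih₂ => exact ih₁.trans ih₂
  exact (key _ _ h).1 (hR.refl d)

variable {rD : D → D → Prop} {u : D ≃ E ⊕ E'}

theorem eqvGen_map {A B : Type*} {p : A → A → Prop} {p' : B → B → Prop} (f : A → B)
    (h : ∀ x y, p x y → Relation.EqvGen p' (f x) (f y)) {x y : A} (hxy : Relation.EqvGen p x y) :
    Relation.EqvGen p' (f x) (f y) := by
  induction hxy with
  | rel x y hxy => exact h x y hxy
  | refl x => exact .refl _
  | symm x y _ ih => exact ih.symm _ _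
  | trans x y z _ _ ih₁ ih₂ => exact ih₁.trans _ _ _ ih₂

/-- If `R` already contains the connections through `E'` and is generated by them together with `r`,
then gluing in `E'` connects nothing further within `E`. This is what allows the other part of a
diagram to be replaced by a matching. -/
theorem eqvGen_glued_iff (hrD : ∀ x y, rD x y ↔ glueRel r r' s s' (u x) (u y))
    (hR : Equivalence R) (hr : ∀ d e, r d e → R d e)
    (hs : ∀ a b, Relation.EqvGen r' (s' a) (s' b) → R (s a) (s b))
    (hRr : ∀ d e, R d e → Relation.EqvGen
      (fun d e => r d e ∨ ∃ a b, d = s a ∧ e = s b ∧ Relation.EqvGen r' (s' a) (s' b)) d e)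
    (d e : E) :
    Relation.EqvGen rD (u.symm (Sum.inl d)) (u.symm (Sum.inl e)) ↔ R d e := by
  constructor
  · intro h
    have h' := eqvGen_map u (fun x y h => .rel _ _ ((hrD x y).1 h)) h
    rw [Equiv.apply_symm_apply, Equiv.apply_symm_apply] at h'
    exact eqvGen_glueRel hR hr hs h'
  · intro h
    have hrel : ∀ x y, glueRel r r' s s' x y → Relation.EqvGen rD (u.symm x) (u.symm y) :=
      fun x y h => .rel _ _ ((hrD _ _).2 (by simpa using h))
    refine eqvGen_map (fun d => u.symm (Sum.inl d)) ?_ (hRr d e h)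
    rintro d e (h | ⟨a, b, rfl, rfl, h⟩)
    · exact hrel (Sum.inl d) (Sum.inl e) h
    · refine .trans _ (u.symm (Sum.inr (s' a))) _ (hrel _ _ ⟨a, rfl, rfl⟩) ?_
      refine .trans _ (u.symm (Sum.inr (s' b))) _ ?_ (hrel _ _ ⟨b, rfl, rfl⟩)
      exact eqvGen_map (fun t => u.symm (Sum.inr t)) (fun t t' h => hrel (.inr t) (.inr t') h) h

/-- A path between the two parts has to cross at a glued point. -/
theorem exists_of_eqvGen_glued (hrD : ∀ x y, rD x y ↔ glueRel r r' s s' (u x) (u y))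
    (hR : Equivalence R) (hr : ∀ d e, r d e → R d e)
    (hs : ∀ a b, Relation.EqvGen r' (s' a) (s' b) → R (s a) (s b)) {d : E} {t : E'}
    (h : Relation.EqvGen rD (u.symm (Sum.inl d)) (u.symm (Sum.inr t))) :
    ∃ a, R d (s a) ∧ Relation.EqvGen r' (s' a) t := by
  have h' := eqvGen_map u (fun x y h => .rel _ _ ((hrD x y).1 h)) h
  rw [Equiv.apply_symm_apply, Equiv.apply_symm_apply] at h'
  exact eqvGen_glueRel hR hr hs h'

end GlueRel

/-! ### Gluing of crossingless diagrams -/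

section Gluing

variable {κ ι : Type*} {n' : κ → ℕ} {n₀' : ℕ} {n : ι → ℕ} {i : κ}

/-- `C` is obtained from `P` by gluing `Q` into the disc `Dᵢ`; the glued points are cutting points
of `C`. -/
structure Gluing (P : ArcDiagram n' n₀') (Q : ArcDiagram n (n' i))
    (C : ArcDiagram (compSig n' i n) n₀') where
  ends : Ends C.Pt (compSig n' i n) n₀' ≃ Ends P.Pt n' n₀' ⊕ Ends Q.Pt n (n' i)
  ends_edge : ∀ e, ends (C.edge e) = Sum.map P.edge Q.edge (ends e)
  ends_outer : ∀ a, ends (outerEnd a) = Sum.inl (outerEnd a)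
  ends_left : ∀ (j : {j : κ // j ≠ i}) (a : Fin (2 * n' j.1)),
    ends (innerEnd (Sum.inl j) a) = Sum.inl (innerEnd j.1 a)
  ends_right : ∀ (k : ι) (a : Fin (2 * n k)),
    ends (innerEnd (Sum.inr k) a) = Sum.inr (innerEnd k a)
  exists_pt_left : ∀ p, ∃ c : C.Pt, ends (Sum.inl c) = Sum.inl (Sum.inl p) ∧
    ends (Sum.inl (C.join c)) = Sum.inl (Sum.inl (P.join p))
  exists_pt_right : ∀ p, ∃ c : C.Pt, ends (Sum.inl c) = Sum.inr (Sum.inl p) ∧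
    ends (Sum.inl (C.join c)) = Sum.inr (Sum.inl (Q.join p))
  exists_pt_glued : ∀ a, ∃ c : C.Pt, ends (Sum.inl c) = Sum.inl (innerEnd i a) ∧
    ends (Sum.inl (C.join c)) = Sum.inr (outerEnd a)

namespace Filling

variable {P : ArcDiagram n n₀'} {F : Filling P}

theorem circleOf_eq_iff {d e : Ends P.Pt n n₀'} :
    F.circleOf d = F.circleOf e ↔ Relation.EqvGen (pathStep P.edge F.link ∅) d e := by
  have : pathStep P.edge F.link ∅ = fun d e => e = P.edge d ∨ e = F.link d := by
    funext d e
    simp [pathStep]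
  rw [this]
  exact Quot.eq

end Filling

/-! ### Paths and circles of a glued diagram -/

namespace Gluing

variable {P : ArcDiagram n' n₀'} {Q : ArcDiagram n (n' i)} {C : ArcDiagram (compSig n' i n) n₀'}

/-- The fillings `F₁` and `F₂` of the two parts are obtained from the filling `F` by replacing the
other part by the planar matching that it induces on the glued circle. -/
structure Compatible (F : Filling C) (F₁ : Filling P) (F₂ : Filling Q) : Prop where
  outer : F.outer = F₁.outer
  left : ∀ j : {j : κ // j ≠ i}, F.inner (Sum.inl j) = F₁.inner j.1
  right : ∀ k : ι, F.inner (Sum.inr k) = F₂.inner k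
  inside : ∀ a, F₂.ConnectedOff none (outerEnd a) (outerEnd ((F₁.inner i).perm a))
  outside : ∀ a, F₁.ConnectedOff (some i) (innerEnd i a) (innerEnd i (F₂.outer.perm a))

variable (g : Gluing P Q C) {F : Filling C} {F₁ : Filling P} {F₂ : Filling Q}

namespace Compatible

theorem ends_link_inl (hF : Compatible F F₁ F₂) {x : Ends C.Pt (compSig n' i n) n₀'}
    {d : Ends P.Pt n' n₀'} (hx : g.ends x = Sum.inl d) (hd : d ∉ discEnds (some i)) :
    g.ends (F.link x) = Sum.inl (F₁.link d) := by
  obtain rfl : x = g.ends.symm (Sum.inl d) := by rw [← hx, Equiv.symm_apply_apply]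
  rcases d with p | ⟨j, a⟩ | a
  · obtain ⟨c, hc, hc'⟩ := g.exists_pt_left p
    rw [← hc, Equiv.symm_apply_apply]
    exact hc'
  · have hj : j ≠ i := by
      rintro rfl
      exact hd ⟨a, rfl⟩
    rw [← g.ends_left ⟨j, hj⟩ a, Equiv.symm_apply_apply]
    refine (g.ends_left ⟨j, hj⟩ ((F.inner (Sum.inl ⟨j, hj⟩)).perm a)).trans ?_
    exact congrArg (fun m : NCMatching (n' j) => Sum.inl (innerEnd j (m.perm a))) (hF.left ⟨j, hj⟩)
  · rw [← g.ends_outer a, Equiv.symm_apply_apply, Filling.link_outerEnd, hF.outer]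
    exact g.ends_outer _

theorem ends_link_inr (hF : Compatible F F₁ F₂) {x : Ends C.Pt (compSig n' i n) n₀'}
    {d : Ends Q.Pt n (n' i)} (hx : g.ends x = Sum.inr d) (hd : d ∉ discEnds none) :
    g.ends (F.link x) = Sum.inr (F₂.link d) := by
  obtain rfl : x = g.ends.symm (Sum.inr d) := by rw [← hx, Equiv.symm_apply_apply]
  rcases d with p | ⟨k, a⟩ | a
  · obtain ⟨c, hc, hc'⟩ := g.exists_pt_right p
    rw [← hc, Equiv.symm_apply_apply]
    exact hc'
  · rw [← g.ends_right k a, Equiv.symm_apply_apply]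
    refine (g.ends_right k ((F.inner (Sum.inr k)).perm a)).trans ?_
    exact congrArg (fun m : NCMatching (n k) => Sum.inr (innerEnd k (m.perm a))) (hF.right k)
  · exact absurd ⟨a, rfl⟩ hd

end Compatible

theorem ends_link_glued {x : Ends C.Pt (compSig n' i n) n₀'} {a : Fin (2 * n' i)}
    (hx : g.ends x = Sum.inl (innerEnd i a)) : g.ends (F.link x) = Sum.inr (outerEnd a) := by
  obtain ⟨c, hc, hc'⟩ := g.exists_pt_glued a
  obtain rfl : x = Sum.inl c := g.ends.injective (hx.trans hc.symm)
  exact hc'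

theorem ends_link_glued_symm {x : Ends C.Pt (compSig n' i n) n₀'} {a : Fin (2 * n' i)}
    (hx : g.ends x = Sum.inr (outerEnd a)) : g.ends (F.link x) = Sum.inl (innerEnd i a) := by
  obtain ⟨c, hc, hc'⟩ := g.exists_pt_glued a
  obtain rfl : x = Sum.inl (C.join c) := g.ends.injective (hx.trans hc'.symm)
  rw [Filling.link_inl, C.join_join, hc]

namespace Compatible

variable {Z : Set (Ends C.Pt (compSig n' i n) n₀')} {Z₁ : Set (Ends P.Pt n' n₀')}
  {Z₂ : Set (Ends Q.Pt n (n' i))}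

/-- A strand of the glued diagram moves as in one of the parts until it meets the glued circle,
where it changes sides instead of following a matching arc. The set `Z` at which paths stop must
avoid that circle. -/
theorem pathStep_iff (hF : Compatible F F₁ F₂)
    (hZ : ∀ x, x ∈ Z ↔ Sum.elim (· ∈ Z₁) (· ∈ Z₂) (g.ends x))
    (h₁ : ∀ a, innerEnd i a ∉ Z₁) (h₂ : ∀ a, outerEnd a ∉ Z₂)
    (x y : Ends C.Pt (compSig n' i n) n₀') :
    pathStep C.edge F.link Z x y ↔
      glueRel (pathStep P.edge F₁.link (Z₁ ∪ discEnds (some i)))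
        (pathStep Q.edge F₂.link (Z₂ ∪ discEnds none)) (innerEnd i) outerEnd
        (g.ends x) (g.ends y) := by
  have h1 : pathStep C.edge F.link Z x y ↔ g.ends y = Sum.map P.edge Q.edge (g.ends x) ∨
      ¬ Sum.elim (· ∈ Z₁) (· ∈ Z₂) (g.ends x) ∧ g.ends y = g.ends (F.link x) := by
    rw [← hZ, ← g.ends_edge, g.ends.injective.eq_iff, g.ends.injective.eq_iff]
    exact Iff.rfl
  rw [h1]
  rcases hx : g.ends x with d | d
  · by_cases hd : d ∈ discEnds (some i)
    · obtain ⟨a, rfl⟩ := hd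
      rw [g.ends_link_glued hx]
      rcases g.ends y with e | e
      · simp [glueRel, pathStep, discEnds]
      · have := h₁ a
        simp only [glueRel, Sum.map_inl, reduceCtorEq, Sum.elim_inl, false_or, this,
          not_false_eq_true, true_and, Sum.inr.injEq]
        constructor
        · rintro rfl
          exact ⟨a, rfl, rfl⟩
        · rintro ⟨b, hb, rfl⟩
          have hab : a = b := by simpa using hb
          rw [hab]
    · rw [hF.ends_link_inl g hx hd]
      rcases g.ends y with e | e
      · simp [glueRel, pathStep, hd]
      · simp only [glueRel, Sum.map_inl, reduceCtorEq, and_false, or_false, false_iff]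
        rintro ⟨a, rfl, -⟩
        exact hd ⟨a, rfl⟩
  · by_cases hd : d ∈ discEnds none
    · obtain ⟨a, rfl⟩ := hd
      rw [g.ends_link_glued_symm hx]
      rcases g.ends y with e | e
      · have := h₂ a
        simp only [glueRel, Sum.map_inr, reduceCtorEq, Sum.elim_inr, false_or, this,
          not_false_eq_true, true_and, Sum.inl.injEq]
        constructor
        · rintro rfl
          exact ⟨a, rfl, rfl⟩
        · rintro ⟨b, rfl, hb⟩
          have hab : a = b := by simpa using hb
          rw [hab]
      · simp [glueRel, pathStep, discEnds]
    · rw [hF.ends_link_inr g hx hd]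
      rcases g.ends y with e | e
      · simp only [glueRel, Sum.map_inr, reduceCtorEq, and_false, or_false, false_iff]
        rintro ⟨a, -, rfl⟩
        exact hd ⟨a, rfl⟩
      · simp [glueRel, pathStep, hd]

theorem eqvGen_pathStep_mono {E : Type*} {α ℓ : E → E} {Z Z' : Set E} (h : Z ⊆ Z') {d e : E}
    (hde : Relation.EqvGen (pathStep α ℓ Z') d e) : Relation.EqvGen (pathStep α ℓ Z) d e :=
  hde.mono fun _ _ h' => h'.imp_right fun h'' => ⟨fun hz => h''.1 (h hz), h''.2⟩

theorem circleOf_glued (F : Filling C) (a : Fin (2 * n' i)) :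
    F.circleOf (g.ends.symm (Sum.inl (innerEnd i a))) =
      F.circleOf (g.ends.symm (Sum.inr (outerEnd a))) := by
  refine Quot.sound (Or.inr ?_)
  rw [Equiv.symm_apply_eq, g.ends_link_glued]
  rw [Equiv.apply_symm_apply]

section Left

variable [Finite ι]

/-- A strand of `Q` entering at a glued point has only one other end on `∂D₀`, and by compatibility
the matching of `F₁` at `Dᵢ` joins these same two points. -/
theorem eqvGen_left_of_right (hF : Compatible F F₁ F₂) (h₁ : ∀ a, innerEnd i a ∉ Z₁)
    (a b : Fin (2 * n' i))
    (h : Relation.EqvGen (pathStep Q.edge F₂.link (∅ ∪ discEnds none)) (outerEnd a) (outerEnd b)) :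
    Relation.EqvGen (pathStep P.edge F₁.link Z₁) (innerEnd i a) (innerEnd i b) := by
  rw [Set.empty_union] at h
  rcases F₂.eq_or_eq_of_connectedOff (a := none) ⟨a, rfl⟩ ⟨_, rfl⟩ ⟨b, rfl⟩
    (fun h => (F₁.inner i).perm_ne a (Filling.outerEnd_injective h)) (hF.inside a) h with h | h
  · rw [Filling.outerEnd_injective h]
    exact .refl _
  · rw [Filling.outerEnd_injective h]
    exact .rel _ _ (Or.inr ⟨h₁ a, rfl⟩)

/-- Every excursion into `Q` can be traded for an arc of the matching of `F₁` inside `Dᵢ`, and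
conversely. As `Z` has no points in `Q`, nothing stops the excursion. -/
theorem eqvGen_left_iff (hF : Compatible F F₁ F₂)
    (hZ : ∀ x, x ∈ Z ↔ Sum.elim (· ∈ Z₁) (fun _ => False) (g.ends x))
    (h₁ : ∀ a, innerEnd i a ∉ Z₁) (d e : Ends P.Pt n' n₀') :
    Relation.EqvGen (pathStep C.edge F.link Z) (g.ends.symm (Sum.inl d))
      (g.ends.symm (Sum.inl e)) ↔ Relation.EqvGen (pathStep P.edge F₁.link Z₁) d e := by
  refine eqvGen_glued_iff (hF.pathStep_iff g (Z₂ := ∅) hZ h₁ (by simp))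
    (Relation.EqvGen.is_equivalence _)
    (fun d e h => eqvGen_pathStep_mono Set.subset_union_left (.rel _ _ h))
    (hF.eqvGen_left_of_right h₁) ?_ d e
  refine fun d e h => eqvGen_map id ?_ h
  rintro d e (rfl | ⟨hd, rfl⟩)
  · exact .rel _ _ (Or.inl (Or.inl rfl))
  · by_cases hi : d ∈ discEnds (some i)
    · obtain ⟨a, rfl⟩ := hi
      refine .rel _ _ (Or.inr ⟨a, _, rfl, rfl, ?_⟩)
      rw [Set.empty_union]
      exact hF.inside a
    · exact .rel _ _ (Or.inl (Or.inr ⟨by simp [hd, hi], rfl⟩))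

theorem circleOf_left_iff (hF : Compatible F F₁ F₂) (d e : Ends P.Pt n' n₀') :
    F.circleOf (g.ends.symm (Sum.inl d)) = F.circleOf (g.ends.symm (Sum.inl e)) ↔
      F₁.circleOf d = F₁.circleOf e := by
  rw [Filling.circleOf_eq_iff, Filling.circleOf_eq_iff]
  refine hF.eqvGen_left_iff g (fun x => ?_) (by simp) d e
  rcases g.ends x with d | d <;> simp

theorem exists_glued_of_circleOf_eq (hF : Compatible F F₁ F₂) {d : Ends P.Pt n' n₀'}
    {t : Ends Q.Pt n (n' i)}
    (h : F.circleOf (g.ends.symm (Sum.inl d)) = F.circleOf (g.ends.symm (Sum.inr t))) :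
    ∃ a, F₁.circleOf d = F₁.circleOf (innerEnd i a) ∧
      F₂.circleOf t = F₂.circleOf (outerEnd a) := by
  rw [Filling.circleOf_eq_iff] at h
  obtain ⟨a, ha, ha'⟩ := exists_of_eqvGen_glued
    (hF.pathStep_iff g (Z₁ := ∅) (Z₂ := ∅) (fun x => by rcases g.ends x with d | d <;> simp)
      (by simp) (by simp)) (Relation.EqvGen.is_equivalence _)
    (fun d e h => eqvGen_pathStep_mono Set.subset_union_left (.rel _ _ h))
    (hF.eqvGen_left_of_right (by simp)) h
  exact ⟨a, Filling.circleOf_eq_iff.2 ha,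
    (Filling.circleOf_eq_iff.2 (eqvGen_pathStep_mono (Set.empty_subset _) ha')).symm⟩

end Left

section Right

variable [Finite κ]

theorem eqvGen_right_of_left (hF : Compatible F F₁ F₂) (h₂ : ∀ a, outerEnd a ∉ Z₂)
    (a b : Fin (2 * n' i))
    (h : Relation.EqvGen (pathStep P.edge F₁.link (∅ ∪ discEnds (some i)))
      (innerEnd i a) (innerEnd i b)) :
    Relation.EqvGen (pathStep Q.edge F₂.link Z₂) (outerEnd a) (outerEnd b) := by
  rw [Set.empty_union] at h
  rcases F₁.eq_or_eq_of_connectedOff (a := some i) ⟨a, rfl⟩ ⟨_, rfl⟩ ⟨b, rfl⟩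
    (fun h => F₂.outer.perm_ne a (Filling.innerEnd_injective i h)) (hF.outside a) h with h | h
  · rw [Filling.innerEnd_injective i h]
    exact .refl _
  · rw [Filling.innerEnd_injective i h]
    exact .rel _ _ (Or.inr ⟨h₂ a, rfl⟩)

/-- The mirror image of `eqvGen_left_iff`: excursions into `P` are traded for arcs outside `D₀`. -/
theorem eqvGen_right_iff (hF : Compatible F F₁ F₂)
    (hZ : ∀ x, x ∈ Z ↔ Sum.elim (fun _ => False) (· ∈ Z₂) (g.ends x))
    (h₂ : ∀ a, outerEnd a ∉ Z₂) (d e : Ends Q.Pt n (n' i)) :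
    Relation.EqvGen (pathStep C.edge F.link Z) (g.ends.symm (Sum.inr d))
      (g.ends.symm (Sum.inr e)) ↔ Relation.EqvGen (pathStep Q.edge F₂.link Z₂) d e := by
  refine eqvGen_glued_iff (u := g.ends.trans (Equiv.sumComm _ _))
    (r := pathStep Q.edge F₂.link (Z₂ ∪ discEnds none)) (s := outerEnd)
    (fun x y => (hF.pathStep_iff g (Z₁ := ∅) hZ (by simp) h₂ x y).trans (glueRel_swap _ _).symm)
    (Relation.EqvGen.is_equivalence _)
    (fun d e h => eqvGen_pathStep_mono Set.subset_union_left (.rel _ _ h))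
    (hF.eqvGen_right_of_left h₂) ?_ d e
  refine fun d e h => eqvGen_map id ?_ h
  rintro d e (rfl | ⟨hd, rfl⟩)
  · exact .rel _ _ (Or.inl (Or.inl rfl))
  · by_cases hi : d ∈ discEnds none
    · obtain ⟨a, rfl⟩ := hi
      refine .rel _ _ (Or.inr ⟨a, _, rfl, rfl, ?_⟩)
      rw [Set.empty_union]
      exact hF.outside a
    · exact .rel _ _ (Or.inl (Or.inr ⟨by simp [hd, hi], rfl⟩))

theorem circleOf_right_iff (hF : Compatible F F₁ F₂) (d e : Ends Q.Pt n (n' i)) :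
    F.circleOf (g.ends.symm (Sum.inr d)) = F.circleOf (g.ends.symm (Sum.inr e)) ↔
      F₂.circleOf d = F₂.circleOf e := by
  rw [Filling.circleOf_eq_iff, Filling.circleOf_eq_iff]
  refine hF.eqvGen_right_iff g (fun x => ?_) (by simp) d e
  rcases g.ends x with d | d <;> simp

end Right

end Compatible

/-! #### Boundary arcs of a glued diagram -/

theorem mem_discEnds_outer (x : Ends C.Pt (compSig n' i n) n₀') :
    x ∈ discEnds none ↔ Sum.elim (· ∈ discEnds none) (fun _ => False) (g.ends x) := by
  constructor
  · rintro ⟨a, rfl⟩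
    rw [g.ends_outer]
    exact ⟨a, rfl⟩
  · intro h
    rcases hx : g.ends x with d | d <;> rw [hx] at h
    · obtain ⟨a, rfl⟩ := h
      exact ⟨a, g.ends.injective (by rw [hx, g.ends_outer])⟩
    · exact h.elim

theorem mem_discEnds_left (j : {j : κ // j ≠ i}) (x : Ends C.Pt (compSig n' i n) n₀') :
    x ∈ discEnds (some (Sum.inl j)) ↔
      Sum.elim (· ∈ discEnds (some j.1)) (fun _ => False) (g.ends x) := by
  constructor
  · rintro ⟨a, rfl⟩
    exact (congrArg (Sum.elim (· ∈ discEnds (some j.1)) fun _ => False) (g.ends_left j a)).mpr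
      ⟨a, rfl⟩
  · intro h
    rcases hx : g.ends x with d | d <;> rw [hx] at h
    · obtain ⟨a, rfl⟩ := h
      exact ⟨a, g.ends.injective ((g.ends_left j a).trans hx.symm)⟩
    · exact h.elim

theorem mem_discEnds_right (k : ι) (x : Ends C.Pt (compSig n' i n) n₀') :
    x ∈ discEnds (some (Sum.inr k)) ↔
      Sum.elim (fun _ => False) (· ∈ discEnds (some k)) (g.ends x) := by
  constructor
  · rintro ⟨a, rfl⟩
    exact (congrArg (Sum.elim (fun _ => False) (· ∈ discEnds (some k))) (g.ends_right k a)).mpr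
      ⟨a, rfl⟩
  · intro h
    rcases hx : g.ends x with d | d <;> rw [hx] at h
    · exact h.elim
    · obtain ⟨a, rfl⟩ := h
      exact ⟨a, g.ends.injective ((g.ends_right k a).trans hx.symm)⟩

theorem symm_outerEnd (a : Fin (2 * n₀')) : g.ends.symm (Sum.inl (outerEnd a)) = outerEnd a := by
  rw [Equiv.symm_apply_eq, g.ends_outer]

theorem symm_innerEnd_left (j : {j : κ // j ≠ i}) (a : Fin (2 * n' j.1)) :
    g.ends.symm (Sum.inl (innerEnd j.1 a)) = innerEnd (Sum.inl j) a := by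
  rw [Equiv.symm_apply_eq]
  exact (g.ends_left j a).symm

theorem symm_innerEnd_right (k : ι) (a : Fin (2 * n k)) :
    g.ends.symm (Sum.inr (innerEnd k a)) = innerEnd (Sum.inr k) a := by
  rw [Equiv.symm_apply_eq]
  exact (g.ends_right k a).symm

namespace Compatible

/-- Arcs that stop at a disc surviving the gluing can be followed in the part containing that disc,
so cutting preserves its boundary matching. The next two lemmas treat the inside discs. -/
theorem connectedOff_outer_iff [Finite ι] (g : Gluing P Q C)
    (hF : Compatible F F₁ F₂) (a b : Fin (2 * n₀')) :
    F.ConnectedOff none (outerEnd a) (outerEnd b) ↔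
      F₁.ConnectedOff none (outerEnd a) (outerEnd b) := by
  have h := hF.eqvGen_left_iff g g.mem_discEnds_outer (by simp [discEnds]) (outerEnd a) (outerEnd b)
  rwa [g.symm_outerEnd, g.symm_outerEnd] at h

theorem connectedOff_left_iff [Finite ι] (g : Gluing P Q C)
    (hF : Compatible F F₁ F₂) (j : {j : κ // j ≠ i})
    (a b : Fin (2 * n' j.1)) :
    F.ConnectedOff (some (Sum.inl j)) (innerEnd (Sum.inl j) a) (innerEnd (Sum.inl j) b) ↔
      F₁.ConnectedOff (some j.1) (innerEnd j.1 a) (innerEnd j.1 b) := by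
  have h := hF.eqvGen_left_iff g (g.mem_discEnds_left j) (by
    rintro a ⟨b, h⟩
    simp only [Sum.inr.injEq, Sum.inl.injEq, Sigma.mk.injEq] at h
    exact j.2 h.1) (innerEnd j.1 a) (innerEnd j.1 b)
  rw [g.symm_innerEnd_left] at h
  erw [g.symm_innerEnd_left] at h
  exact h

theorem connectedOff_right_iff [Finite κ] (g : Gluing P Q C)
    (hF : Compatible F F₁ F₂) (k : ι)
    (a b : Fin (2 * n k)) :
    F.ConnectedOff (some (Sum.inr k)) (innerEnd (Sum.inr k) a) (innerEnd (Sum.inr k) b) ↔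
      F₂.ConnectedOff (some k) (innerEnd k a) (innerEnd k b) := by
  have h := hF.eqvGen_right_iff g (g.mem_discEnds_right k) (by simp [discEnds])
    (innerEnd k a) (innerEnd k b)
  rw [g.symm_innerEnd_right] at h
  erw [g.symm_innerEnd_right] at h
  exact h

end Compatible

end Gluing

end Gluing

/-! ### Weights of glued links -/

namespace Filling

variable {ι : Type*} {n : ι → ℕ} {n₀ : ℕ} {P : ArcDiagram n n₀} (F : Filling P)

/-- The circle meets the boundary of the disc. -/
def Meets (a : Option ι) (C : F.Circle) : Prop := ∃ e ∈ discEnds a, F.circleOf e = C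

open scoped Classical in
theorem numDiscs_eq_sum [Fintype ι] (C : F.Circle) :
    F.numDiscs C = (if F.Meets none C then 1 else 0) + ∑ i, if F.Meets (some i) C then 1 else 0 := by
  have h : F.numDiscs C = ∑ a : Option ι, if F.Meets a C then 1 else 0 := by
    rw [← Finset.card_filter, ← Fintype.card_subtype, ← Nat.card_eq_fintype_card]
    rfl
  rw [h, Fintype.sum_option]

end Filling

section Gluing

variable {κ ι : Type*} {n' : κ → ℕ} {n₀' : ℕ} {n : ι → ℕ} {i : κ}
  {P : ArcDiagram n' n₀'} {Q : ArcDiagram n (n' i)} {C : ArcDiagram (compSig n' i n) n₀'}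
  (g : Gluing P Q C)

namespace Gluing.Compatible

variable {g} {F : Filling C} {F₁ : Filling P} {F₂ : Filling Q}

/-- The circle of the glued link that contains (part of) a given circle of the left hand link. -/
def leftCircle [Finite ι] (g : Gluing P Q C) (hF : Compatible F F₁ F₂) (c : F₁.Circle) : F.Circle :=
  Quot.lift (fun d => F.circleOf (g.ends.symm (Sum.inl d)))
    (fun d e h => (hF.circleOf_left_iff g d e).2 (Quot.sound h)) c

/-- The circle of the glued link that contains (part of) a given circle of the right hand link. -/
def rightCircle [Finite κ] (g : Gluing P Q C) (hF : Compatible F F₁ F₂) (c : F₂.Circle) :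
    F.Circle :=
  Quot.lift (fun d => F.circleOf (g.ends.symm (Sum.inr d)))
    (fun d e h => (hF.circleOf_right_iff g d e).2 (Quot.sound h)) c

/-- Pieces of the left part on one glued circle are joined by excursions to the right, and these are
already arcs of `F₁`. So a glued circle never splits into several circles of one part. -/
theorem leftCircle_injective [Finite ι] (hF : Compatible F F₁ F₂) :
    Function.Injective (hF.leftCircle g) := by
  rintro ⟨d⟩ ⟨e⟩ h
  exact (hF.circleOf_left_iff g d e).1 h

theorem rightCircle_injective [Finite κ] (hF : Compatible F F₁ F₂) :
    Function.Injective (hF.rightCircle g) := by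
  rintro ⟨d⟩ ⟨e⟩ h
  exact (hF.circleOf_right_iff g d e).1 h

theorem meets_iff_left [Finite ι] (hF : Compatible F F₁ F₂) {a : Option ({j : κ // j ≠ i} ⊕ ι)}
    {b : Option κ}
    (hab : ∀ x, x ∈ discEnds a ↔ Sum.elim (· ∈ discEnds b) (fun _ => False) (g.ends x))
    (c : F.Circle) : F.Meets a c ↔ ∃ c₁, hF.leftCircle g c₁ = c ∧ F₁.Meets b c₁ := by
  constructor
  · rintro ⟨x, hx, rfl⟩
    rw [hab] at hx
    rcases hd : g.ends x with d | d <;> rw [hd] at hx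
    · refine ⟨F₁.circleOf d, ?_, d, hx, rfl⟩
      change F.circleOf (g.ends.symm (Sum.inl d)) = _
      rw [← hd, Equiv.symm_apply_apply]
    · exact hx.elim
  · rintro ⟨_, rfl, d, hd, rfl⟩
    exact ⟨g.ends.symm (Sum.inl d), by rw [hab, Equiv.apply_symm_apply]; exact hd, rfl⟩

theorem meets_iff_right [Finite κ] (hF : Compatible F F₁ F₂) (k : ι) (c : F.Circle) :
    F.Meets (some (Sum.inr k)) c ↔ ∃ c₂, hF.rightCircle g c₂ = c ∧ F₂.Meets (some k) c₂ := by
  constructor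
  · rintro ⟨x, hx, rfl⟩
    rw [g.mem_discEnds_right] at hx
    rcases hd : g.ends x with d | d <;> rw [hd] at hx
    · exact hx.elim
    · refine ⟨F₂.circleOf d, ?_, d, hx, rfl⟩
      change F.circleOf (g.ends.symm (Sum.inr d)) = _
      rw [← hd, Equiv.symm_apply_apply]
  · rintro ⟨_, rfl, d, hd, rfl⟩
    exact ⟨g.ends.symm (Sum.inr d), by
      rw [g.mem_discEnds_right, Equiv.apply_symm_apply]; exact hd, rfl⟩

/-- A circle lying in both parts passes through a glued point. -/
theorem meets_of_leftCircle_eq [Finite ι] [Finite κ] (hF : Compatible F F₁ F₂) {c₁ : F₁.Circle}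
    {c₂ : F₂.Circle} (h : hF.leftCircle g c₁ = hF.rightCircle g c₂) :
    F₁.Meets (some i) c₁ ∧ F₂.Meets none c₂ := by
  induction c₁ using Quot.inductionOn with | h d => ?_
  induction c₂ using Quot.inductionOn with | h t => ?_
  obtain ⟨a, ha, ha'⟩ := hF.exists_glued_of_circleOf_eq g h
  exact ⟨⟨_, ⟨a, rfl⟩, ha.symm⟩, ⟨_, ⟨a, rfl⟩, ha'.symm⟩⟩

theorem exists_rightCircle_eq [Finite ι] [Finite κ] (hF : Compatible F F₁ F₂) {c₁ : F₁.Circle}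
    (h : F₁.Meets (some i) c₁) : ∃ c₂, hF.rightCircle g c₂ = hF.leftCircle g c₁ := by
  obtain ⟨_, ⟨a, rfl⟩, rfl⟩ := h
  exact ⟨F₂.circleOf (outerEnd a), (circleOf_glued g F a).symm⟩

theorem exists_leftCircle_eq [Finite ι] [Finite κ] (hF : Compatible F F₁ F₂) {c₂ : F₂.Circle}
    (h : F₂.Meets none c₂) : ∃ c₁, hF.leftCircle g c₁ = hF.rightCircle g c₂ := by
  obtain ⟨_, ⟨a, rfl⟩, rfl⟩ := h
  exact ⟨F₁.circleOf (innerEnd i a), circleOf_glued g F a⟩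

theorem exists_circle [Finite ι] [Finite κ] (hF : Compatible F F₁ F₂) (c : F.Circle) :
    (∃ c₁, hF.leftCircle g c₁ = c) ∨ ∃ c₂, hF.rightCircle g c₂ = c := by
  induction c using Quot.inductionOn with | h x => ?_
  rcases hx : g.ends x with d | d
  · refine Or.inl ⟨F₁.circleOf d, ?_⟩
    change F.circleOf (g.ends.symm (Sum.inl d)) = _
    rw [← hx, Equiv.symm_apply_apply]
    rfl
  · refine Or.inr ⟨F₂.circleOf d, ?_⟩
    change F.circleOf (g.ends.symm (Sum.inr d)) = _
    rw [← hx, Equiv.symm_apply_apply]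
    rfl

section Count

open scoped Classical

variable [Finite ι] [Finite κ]

/-- Such a circle misses `Dᵢ`, since a circle meeting `Dᵢ` would continue into the right part; all
discs that it meets survive the gluing. -/
theorem numDiscs_leftCircle (hF : Compatible F F₁ F₂) {c₁ : F₁.Circle}
    (h : ∀ c₂, hF.rightCircle g c₂ ≠ hF.leftCircle g c₁) :
    F.numDiscs (hF.leftCircle g c₁) = F₁.numDiscs c₁ := by
  have := Fintype.ofFinite ι
  have := Fintype.ofFinite κ
  have hex : ∀ p : F₁.Circle → Prop,
      (∃ c, hF.leftCircle g c = hF.leftCircle g c₁ ∧ p c) ↔ p c₁ := fun p =>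
    ⟨fun ⟨c, hc, hp⟩ => hF.leftCircle_injective hc ▸ hp, fun hp => ⟨c₁, rfl, hp⟩⟩
  have hi : ¬ F₁.Meets (some i) c₁ := fun hm => by
    obtain ⟨c₂, hc₂⟩ := hF.exists_rightCircle_eq (g := g) hm
    exact h c₂ hc₂
  rw [F.numDiscs_eq_sum, F₁.numDiscs_eq_sum, Fintype.sum_sum_type,
    Fintype.sum_eq_add_sum_subtype_ne _ i]
  simp only [hF.meets_iff_left g.mem_discEnds_outer, hF.meets_iff_left (g.mem_discEnds_left _),
    hF.meets_iff_right (g := g), hex, h, hi, false_and, exists_false, if_false,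
    Finset.sum_const_zero, add_zero, zero_add]

theorem numDiscs_rightCircle (hF : Compatible F F₁ F₂) {c₂ : F₂.Circle}
    (h : ∀ c₁, hF.leftCircle g c₁ ≠ hF.rightCircle g c₂) :
    F.numDiscs (hF.rightCircle g c₂) = F₂.numDiscs c₂ := by
  have := Fintype.ofFinite ι
  have := Fintype.ofFinite κ
  have hex : ∀ p : F₂.Circle → Prop,
      (∃ c, hF.rightCircle g c = hF.rightCircle g c₂ ∧ p c) ↔ p c₂ := fun p =>
    ⟨fun ⟨c, hc, hp⟩ => hF.rightCircle_injective hc ▸ hp, fun hp => ⟨c₂, rfl, hp⟩⟩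
  have hi : ¬ F₂.Meets none c₂ := fun hm => by
    obtain ⟨c₁, hc₁⟩ := hF.exists_leftCircle_eq (g := g) hm
    exact h c₁ hc₁
  rw [F.numDiscs_eq_sum, F₂.numDiscs_eq_sum, Fintype.sum_sum_type]
  simp only [hF.meets_iff_left g.mem_discEnds_outer, hF.meets_iff_left (g.mem_discEnds_left _),
    hF.meets_iff_right (g := g), hex, h, hi, false_and, exists_false, if_false,
    Finset.sum_const_zero, zero_add]

/-- Every surviving disc belongs to exactly one part. The glued circle is counted once in each part
and not at all after gluing, which accounts for the 2. -/
theorem numDiscs_glued (hF : Compatible F F₁ F₂) {c₁ : F₁.Circle} {c₂ : F₂.Circle}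
    (h : hF.leftCircle g c₁ = hF.rightCircle g c₂) :
    F.numDiscs (hF.leftCircle g c₁) + 2 = F₁.numDiscs c₁ + F₂.numDiscs c₂ := by
  have := Fintype.ofFinite ι
  have := Fintype.ofFinite κ
  have hex : ∀ p : F₁.Circle → Prop,
      (∃ c, hF.leftCircle g c = hF.leftCircle g c₁ ∧ p c) ↔ p c₁ := fun p =>
    ⟨fun ⟨c, hc, hp⟩ => hF.leftCircle_injective hc ▸ hp, fun hp => ⟨c₁, rfl, hp⟩⟩
  have hex' : ∀ p : F₂.Circle → Prop,
      (∃ c, hF.rightCircle g c = hF.leftCircle g c₁ ∧ p c) ↔ p c₂ := fun p =>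
    ⟨fun ⟨c, hc, hp⟩ => hF.rightCircle_injective (hc.trans h) ▸ hp, fun hp => ⟨c₂, h.symm, hp⟩⟩
  obtain ⟨h₁, h₂⟩ := hF.meets_of_leftCircle_eq h
  rw [F.numDiscs_eq_sum, F₁.numDiscs_eq_sum, F₂.numDiscs_eq_sum, Fintype.sum_sum_type,
    Fintype.sum_eq_add_sum_subtype_ne _ i]
  simp only [hF.meets_iff_left g.mem_discEnds_outer, hF.meets_iff_left (g.mem_discEnds_left _),
    hF.meets_iff_right (g := g), hex, hex', h₁, h₂, if_true]
  ring

end Count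

end Gluing.Compatible

namespace Gluing

/-- The decorated links `M₁` and `M₂` are the two parts of the decorated link `M`. -/
structure Decorated (M : MultiplyCleaved C) (M₁ : MultiplyCleaved P) (M₂ : MultiplyCleaved Q) :
    Prop where
  fill : Compatible M.fill M₁.fill M₂.fill
  sign_left : ∀ d, M.sign (M.fill.circleOf (g.ends.symm (Sum.inl d))) =
    M₁.sign (M₁.fill.circleOf d)
  sign_right : ∀ d, M.sign (M.fill.circleOf (g.ends.symm (Sum.inr d))) =
    M₂.sign (M₂.fill.circleOf d)

variable {g} {M : MultiplyCleaved C} {M₁ : MultiplyCleaved P} {M₂ : MultiplyCleaved Q}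

theorem prod_fiber {A B K : Type*} [Fintype A] [DecidableEq B] [CommMonoid K] {f : A → B}
    (hf : Function.Injective f) (w : A → K) (a : A) {b : B} (h : f a = b) :
    ∏ x with f x = b, w x = w a := by
  have : Finset.univ.filter (fun x => f x = b) = {a} := by
    ext x
    simp only [Finset.mem_filter, Finset.mem_univ, true_and, Finset.mem_singleton, ← h, hf.eq_iff]
  rw [this, Finset.prod_singleton]

theorem prod_fiber_of_forall_ne {A B K : Type*} [Fintype A] [DecidableEq B] [CommMonoid K]
    {f : A → B} (w : A → K) {b : B} (h : ∀ a, f a ≠ b) : ∏ x with f x = b, w x = 1 := by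
  rw [Finset.filter_false_of_mem (fun x _ => h x), Finset.prod_empty]

/-- The circles of each part are grouped by the glued circle containing them. A group has at most
one member, and two groups over the same glued circle have equal signs, so the claim is one identity
of exponents per glued circle. -/
theorem Decorated.weight_eq [Finite ι] [Finite κ] (hM : g.Decorated M M₁ M₂) :
    M.weight = M₁.weight * M₂.weight := by
  classical
  have hF := hM.fill
  have hL : ∀ c, M.sign (hF.leftCircle g c) = M₁.sign c := by
    rintro ⟨d⟩
    exact hM.sign_left d
  have hR : ∀ c, M.sign (hF.rightCircle g c) = M₂.sign c := by
    rintro ⟨d⟩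
    exact hM.sign_right d
  unfold MultiplyCleaved.weight
  rw [← Finset.prod_fiberwise Finset.univ (hF.leftCircle g),
    ← Finset.prod_fiberwise Finset.univ (hF.rightCircle g), ← Finset.prod_mul_distrib]
  refine Finset.prod_congr rfl fun c _ => ?_
  by_cases h₁ : ∃ c₁, hF.leftCircle g c₁ = c
  · obtain ⟨c₁, rfl⟩ := h₁
    rw [prod_fiber hF.leftCircle_injective _ c₁ rfl]
    by_cases h₂ : ∃ c₂, hF.rightCircle g c₂ = hF.leftCircle g c₁
    · obtain ⟨c₂, h₂⟩ := h₂
      have hN := hF.numDiscs_glued h₂.symm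
      have hs : M₁.sign c₁ = M₂.sign c₂ := by rw [← hL, ← hR, h₂]
      rw [prod_fiber hF.rightCircle_injective _ c₂ h₂, ← LaurentPolynomial.T_add, hL, ← hs]
      congr 1
      -- The identity is `2 - N = (2 - N₁) + (2 - N₂)`, in units of `q^{1/2}`.
      zify at hN
      rw [← mul_add]
      congr 1
      linarith
    · push Not at h₂
      rw [prod_fiber_of_forall_ne _ h₂, mul_one, hL, hF.numDiscs_leftCircle h₂]
  · obtain ⟨c₂, rfl⟩ := (hF.exists_circle c).resolve_left h₁
    push Not at h₁
    rw [prod_fiber_of_forall_ne _ h₁, prod_fiber hF.rightCircle_injective _ c₂ rfl, one_mul, hR,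
      hF.numDiscs_rightCircle h₁]

/-! ### Boundaries of glued links -/

theorem Decorated.hasOuterBoundary_iff [Finite ι] (hM : g.Decorated M M₁ M₂)
    (L : CleavedLink n₀') : M.HasOuterBoundary L ↔ M₁.HasOuterBoundary L := by
  have hs : ∀ a, M.sign (M.fill.circleOf (outerEnd a)) =
      M₁.sign (M₁.fill.circleOf (outerEnd a)) := fun a => by
    rw [← hM.sign_left, g.symm_outerEnd]
  unfold MultiplyCleaved.HasOuterBoundary
  simp only [hM.fill.outer, hM.fill.connectedOff_outer_iff g, hs]

theorem Decorated.hasInnerBoundary_left_iff [Finite ι] (hM : g.Decorated M M₁ M₂)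
    (j : {j : κ // j ≠ i}) (L : CleavedLink (n' j.1)) :
    M.HasInnerBoundary (Sum.inl j) L ↔ M₁.HasInnerBoundary j.1 L := by
  refine and_congr ?_ (and_congr (forall_congr' fun a => ?_) (forall_congr' fun a => ?_))
  · exact iff_of_eq (congrArg (L.inside = ·) (hM.fill.left j))
  · exact hM.fill.connectedOff_left_iff g j _ _
  · exact iff_of_eq (congrArg (L.sign _ = ·)
      ((congrArg (fun e => M.sign (M.fill.circleOf e)) (g.symm_innerEnd_left j a)).symm.trans
        (hM.sign_left _)))

theorem Decorated.hasInnerBoundary_right_iff [Finite κ] (hM : g.Decorated M M₁ M₂)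
    (k : ι) (L : CleavedLink (n k)) :
    M.HasInnerBoundary (Sum.inr k) L ↔ M₂.HasInnerBoundary k L := by
  refine and_congr ?_ (and_congr (forall_congr' fun a => ?_) (forall_congr' fun a => ?_))
  · exact iff_of_eq (congrArg (L.inside = ·) (hM.fill.right k))
  · exact hM.fill.connectedOff_right_iff g k _ _
  · exact iff_of_eq (congrArg (L.sign _ = ·)
      ((congrArg (fun e => M.sign (M.fill.circleOf e)) (g.symm_innerEnd_right k a)).symm.trans
        (hM.sign_right _)))

end Gluing

end Gluing

/-! ### Cutting and gluing decorated links -/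

theorem NCMatching.ext_perm {n : ℕ} {m m' : NCMatching n} (h : ∀ a, m.perm a = m'.perm a) :
    m = m' := by
  cases m
  cases m'
  congr 1
  exact Equiv.ext h

/-- The matching that joins the first point to the last one, and so on. -/
def NCMatching.nested (n : ℕ) : NCMatching n where
  perm := Fin.revPerm
  perm_perm := Fin.rev_rev
  perm_ne a h := by
    have := congrArg Fin.val h
    rw [Fin.revPerm_apply, Fin.val_rev] at this
    omega
  noncrossing a b h := by
    simp only [Fin.revPerm_apply, Fin.lt_def, Fin.val_rev] at h
    omega

theorem CleavedLink.ext_sign {n : ℕ} {L L' : CleavedLink n} (h₁ : L.inside = L'.inside)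
    (h₂ : L.outside = L'.outside)
    (h₃ : ∀ a, L.sign (Quot.mk _ a) = L'.sign (Quot.mk _ a)) : L = L' := by
  obtain ⟨a, b, s⟩ := L
  obtain ⟨a', b', s'⟩ := L'
  obtain rfl : a = a' := h₁
  obtain rfl : b = b' := h₂
  congr 1
  funext c
  induction c using Quot.inductionOn with | h x => exact h₃ x

theorem Filling.ext_inner {ι : Type*} {n : ι → ℕ} {n₀ : ℕ} {P : ArcDiagram n n₀} {F F' : Filling P}
    (h₁ : F.outer = F'.outer) (h₂ : ∀ i, F.inner i = F'.inner i) : F = F' := by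
  obtain ⟨a, b⟩ := F
  obtain ⟨a', b'⟩ := F'
  obtain rfl : a = a' := h₁
  obtain rfl : b = b' := funext h₂
  rfl

theorem MultiplyCleaved.ext_sign {ι : Type*} {n : ι → ℕ} {n₀ : ℕ} {P : ArcDiagram n n₀}
    {M M' : MultiplyCleaved P} (h₁ : M.fill = M'.fill)
    (h₂ : ∀ e, M.sign (M.fill.circleOf e) = M'.sign (M'.fill.circleOf e)) : M = M' := by
  obtain ⟨F, s⟩ := M
  obtain ⟨F', s'⟩ := M'
  obtain rfl : F = F' := h₁
  congr 1
  funext c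
  induction c using Quot.inductionOn with | h x => exact h₂ x

/-- Arcs off a disc do not depend on the matching at this disc. -/
theorem Filling.ConnectedOff.congr {ι : Type*} {n : ι → ℕ} {n₀ : ℕ} {P : ArcDiagram n n₀}
    {F F' : Filling P} {a : Option ι} (ho : a ≠ none → F.outer = F'.outer)
    (hi : ∀ i, a ≠ some i → F.inner i = F'.inner i) {d e : Ends P.Pt n n₀}
    (h : F.ConnectedOff a d e) : F'.ConnectedOff a d e := by
  refine eqvGen_map id (fun d e h => ?_) h
  rcases h with h | ⟨hd, h⟩
  · exact .rel _ _ (Or.inl h)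
  refine .rel _ _ (Or.inr ⟨hd, h.trans ?_⟩)
  rw [id_eq]
  rcases d with p | ⟨i, x⟩ | x
  · rfl
  · rw [Filling.link_innerEnd, Filling.link_innerEnd, hi i]
    rintro rfl
    exact hd ⟨x, rfl⟩
  · rw [Filling.link_outerEnd, Filling.link_outerEnd, ho]
    rintro rfl
    exact hd ⟨x, rfl⟩

section Insert

variable {κ : Type*} [DecidableEq κ] {i : κ} {X : κ → Type*}

/-- A family with a given member at `i`. -/
def insertMember (y : X i) (a : ∀ j : {j : κ // j ≠ i}, X j.1) (j : κ) : X j :=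
  if h : j = i then h ▸ y else a ⟨j, h⟩

theorem insertMember_self (y : X i) (a : ∀ j : {j : κ // j ≠ i}, X j.1) :
    insertMember y a i = y := by
  simp [insertMember]

theorem insertMember_of_ne (y : X i) (a : ∀ j : {j : κ // j ≠ i}, X j.1) (j : {j : κ // j ≠ i}) :
    insertMember y a j.1 = a j := by
  simp [insertMember, j.2]

end Insert

/-! ### The bijection between glued links and matching pairs of parts -/

namespace Gluing

variable {κ ι : Type*} {n' : κ → ℕ} {n₀' : ℕ} {n : ι → ℕ} {i : κ}
  {P : ArcDiagram n' n₀'} {Q : ArcDiagram n (n' i)} {C : ArcDiagram (compSig n' i n) n₀'}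
  (g : Gluing P Q C)

/-- The common link `L` names both matchings on the glued circle, each being filled in on one side
and realised by arcs on the other. -/
theorem compatible_of_hasBoundary {M₁ : MultiplyCleaved P} {M₂ : MultiplyCleaved Q}
    {L : CleavedLink (n' i)} (h₁ : M₁.HasInnerBoundary i L) (h₂ : M₂.HasOuterBoundary L)
    {F : Filling C} (ho : F.outer = M₁.fill.outer)
    (hl : ∀ j : {j : κ // j ≠ i}, F.inner (Sum.inl j) = M₁.fill.inner j.1)
    (hr : ∀ k : ι, F.inner (Sum.inr k) = M₂.fill.inner k) :
    Compatible F M₁.fill M₂.fill :=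
  ⟨ho, hl, hr, by rw [← h₁.1]; exact h₂.2.1, by rw [← h₂.1]; exact h₁.2.1⟩

/-- Decorated links with the same cleaved link at the glued circle can be glued. -/
theorem exists_decorated [Finite ι] [Finite κ] {M₁ : MultiplyCleaved P} {M₂ : MultiplyCleaved Q}
    {L : CleavedLink (n' i)} (h₁ : M₁.HasInnerBoundary i L) (h₂ : M₂.HasOuterBoundary L) :
    ∃ M, g.Decorated M M₁ M₂ := by
  let F : Filling C := ⟨M₁.fill.outer, fun s => match s with
    | Sum.inl j => M₁.fill.inner j.1
    | Sum.inr k => M₂.fill.inner k⟩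
  have hF : Compatible F M₁.fill M₂.fill :=
    compatible_of_hasBoundary h₁ h₂ rfl (fun _ => rfl) (fun _ => rfl)
  -- The signs of the two parts descend to glued circles because both equal the sign of `L` at each
  -- glued point.
  let t : Ends P.Pt n' n₀' ⊕ Ends Q.Pt n (n' i) → ℤˣ :=
    Sum.elim (fun d => M₁.sign (M₁.fill.circleOf d)) fun d => M₂.sign (M₂.fill.circleOf d)
  have hglue : ∀ a, M₁.sign (M₁.fill.circleOf (innerEnd i a)) =
      M₂.sign (M₂.fill.circleOf (outerEnd a)) := fun a => by rw [← h₁.2.2, ← h₂.2.2]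
  have ht : ∀ x y, F.circleOf (g.ends.symm x) = F.circleOf (g.ends.symm y) → t x = t y := by
    rintro (x | x) (y | y) h
    · exact congrArg M₁.sign ((hF.circleOf_left_iff g x y).1 h)
    · obtain ⟨a, ha, ha'⟩ := hF.exists_glued_of_circleOf_eq g h
      change M₁.sign _ = M₂.sign _
      rw [ha, ha', hglue]
    · obtain ⟨a, ha, ha'⟩ := hF.exists_glued_of_circleOf_eq g h.symm
      change M₂.sign _ = M₁.sign _
      rw [ha, ha', hglue]
    · exact congrArg M₂.sign ((hF.circleOf_right_iff g x y).1 h)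
  refine ⟨⟨F, Quot.lift (fun x => t (g.ends x)) fun x y h => ht _ _ ?_⟩, hF, fun d => ?_,
    fun d => ?_⟩
  · rw [Equiv.symm_apply_apply, Equiv.symm_apply_apply]
    exact Quot.sound h
  · change t (g.ends (g.ends.symm _)) = _
    rw [Equiv.apply_symm_apply]
    rfl
  · change t (g.ends (g.ends.symm _)) = _
    rw [Equiv.apply_symm_apply]
    rfl

variable {g}

theorem Decorated.unique {M M' : MultiplyCleaved C} {M₁ : MultiplyCleaved P}
    {M₂ : MultiplyCleaved Q} (h : g.Decorated M M₁ M₂) (h' : g.Decorated M' M₁ M₂) : M = M' := by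
  refine MultiplyCleaved.ext_sign (Filling.ext_inner (h.fill.outer.trans h'.fill.outer.symm) ?_) ?_
  · rintro (j | k)
    · exact (h.fill.left j).trans (h'.fill.left j).symm
    · exact (h.fill.right k).trans (h'.fill.right k).symm
  · intro e
    obtain ⟨x, rfl⟩ := g.ends.symm.surjective e
    rcases x with d | d
    · rw [h.sign_left, h'.sign_left]
    · rw [h.sign_right, h'.sign_right]

/-- The matching at `Dᵢ` is traced by the arcs of `Q` off `D₀`. These depend only on the inner
matchings, which are read off from `F`, and not on the matching outside `D₀`. -/
theorem Compatible.inner_eq [Finite ι] {F : Filling C} {F₁ F₁' : Filling P} {F₂ F₂' : Filling Q}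
    (h : Compatible F F₁ F₂) (h' : Compatible F F₁' F₂') : F₁.inner i = F₁'.inner i := by
  refine NCMatching.ext_perm fun a => ?_
  have h2 : F₂.ConnectedOff none (outerEnd a) (outerEnd ((F₁'.inner i).perm a)) :=
    (h'.inside a).congr (fun h => absurd rfl h) fun k _ => (h'.right k).symm.trans (h.right k)
  refine ((Filling.outerEnd_injective ((F₂.eq_or_eq_of_connectedOff (a := none) ⟨a, rfl⟩ ⟨_, rfl⟩
    ⟨_, rfl⟩ ?_ (h.inside a) h2).resolve_left ?_))).symm
  · exact fun h => (F₁.inner i).perm_ne a (Filling.outerEnd_injective h)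
  · exact fun h => (F₁'.inner i).perm_ne a (Filling.outerEnd_injective h)

theorem Compatible.outer_eq [Finite κ] {F : Filling C} {F₁ F₁' : Filling P} {F₂ F₂' : Filling Q}
    (h : Compatible F F₁ F₂) (h' : Compatible F F₁' F₂') : F₂.outer = F₂'.outer := by
  refine NCMatching.ext_perm fun a => ?_
  have h2 : F₁.ConnectedOff (some i) (innerEnd i a) (innerEnd i (F₂'.outer.perm a)) :=
    (h'.outside a).congr (fun _ => h'.outer.symm.trans h.outer) fun j hj =>
      (h'.left ⟨j, fun e => hj (e ▸ rfl)⟩).symm.trans (h.left ⟨j, fun e => hj (e ▸ rfl)⟩)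
  refine ((Filling.innerEnd_injective i ((F₁.eq_or_eq_of_connectedOff (a := some i) ⟨a, rfl⟩
    ⟨_, rfl⟩ ⟨_, rfl⟩ ?_ (h.outside a) h2).resolve_left ?_))).symm
  · exact fun h => F₂.outer.perm_ne a (Filling.innerEnd_injective i h)
  · exact fun h => F₂'.outer.perm_ne a (Filling.innerEnd_injective i h)

/-- Away from the glued circle, matchings and signs are read off from `M`. The two matchings on it
are determined by `inner_eq` and `outer_eq`, and then so is the link on it. -/
theorem Decorated.parts_unique [Finite ι] [Finite κ] {M : MultiplyCleaved C}
    {M₁ M₁' : MultiplyCleaved P} {M₂ M₂' : MultiplyCleaved Q} {L L' : CleavedLink (n' i)}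
    (h : g.Decorated M M₁ M₂) (h₁ : M₁.HasInnerBoundary i L) (h₂ : M₂.HasOuterBoundary L)
    (h' : g.Decorated M M₁' M₂') (h₁' : M₁'.HasInnerBoundary i L')
    (h₂' : M₂'.HasOuterBoundary L') : L = L' ∧ M₁ = M₁' ∧ M₂ = M₂' := by
  obtain rfl : M₁ = M₁' := by
    refine MultiplyCleaved.ext_sign
      (Filling.ext_inner (h.fill.outer.symm.trans h'.fill.outer) fun j => ?_) fun e => ?_
    · by_cases hj : j = i
      · subst hj
        exact h.fill.inner_eq h'.fill
      · exact (h.fill.left ⟨j, hj⟩).symm.trans (h'.fill.left ⟨j, hj⟩)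
    · rw [← h.sign_left, ← h'.sign_left]
  obtain rfl : M₂ = M₂' := by
    refine MultiplyCleaved.ext_sign
      (Filling.ext_inner (h.fill.outer_eq h'.fill)
        fun k => (h.fill.right k).symm.trans (h'.fill.right k)) fun e => ?_
    rw [← h.sign_right, ← h'.sign_right]
  refine ⟨CleavedLink.ext_sign (h₁.1.trans h₁'.1.symm) (h₂.1.trans h₂'.1.symm) fun a => ?_, rfl, rfl⟩
  rw [h₁.2.2, h₁'.2.2]

/-- If the two parts induce planar matchings on the glued circle, then every decorated link over the
glued diagram can be cut. -/
theorem exists_parts [Finite ι] [Finite κ] [DecidableEq κ] (g : Gluing P Q C)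
    (hP : ∀ F : Filling P, ∃ m : NCMatching (n' i), ∀ a,
      F.ConnectedOff (some i) (innerEnd i a) (innerEnd i (m.perm a)))
    (hQ : ∀ F : Filling Q, ∃ m : NCMatching (n' i), ∀ a,
      F.ConnectedOff none (outerEnd a) (outerEnd (m.perm a)))
    (M : MultiplyCleaved C) :
    ∃ L M₁ M₂, g.Decorated M M₁ M₂ ∧ M₁.HasInnerBoundary i L ∧ M₂.HasOuterBoundary L := by
  let mr : ∀ k, NCMatching (n k) := fun k => M.fill.inner (Sum.inr k)
  obtain ⟨mi, hmi⟩ := hQ ⟨NCMatching.nested _, mr⟩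
  let ml : ∀ j : {j : κ // j ≠ i}, NCMatching (n' j.1) := fun j => M.fill.inner (Sum.inl j)
  let F₁ : Filling P := ⟨M.fill.outer, insertMember (X := fun j => NCMatching (n' j)) mi ml⟩
  obtain ⟨mo, hmo⟩ := hP F₁
  let F₂ : Filling Q := ⟨mo, mr⟩
  have hF₁ : F₁.inner i = mi := insertMember_self (X := fun j => NCMatching (n' j)) mi ml
  have hinside : ∀ a, F₂.ConnectedOff none (outerEnd a) (outerEnd (mi.perm a)) :=
    fun a => (hmi a).congr (fun h => absurd rfl h) fun _ _ => by rfl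
  have hF : Compatible M.fill F₁ F₂ := ⟨rfl,
    fun j => (insertMember_of_ne (X := fun j => NCMatching (n' j)) mi ml j).symm, fun _ => rfl,
    by rw [hF₁]; exact hinside, hmo⟩
  have hglue := Compatible.circleOf_glued g M.fill
  -- The sign is constant along an inside arc because that arc belongs to the left part, and along
  -- an outside arc because, after passing to the other side of the glued points, it belongs to the
  -- right part.
  let L : CleavedLink (n' i) := ⟨mi, mo,
    Quot.lift (fun a => M.sign (M.fill.circleOf (g.ends.symm (Sum.inl (innerEnd i a))))) (by
      rintro a _ (rfl | rfl)
      · refine congrArg M.sign ((hF.circleOf_left_iff g _ _).2 (Quot.sound (Or.inr ?_)))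
        rw [Filling.link_innerEnd, hF₁]
      · refine congrArg M.sign ?_
        rw [hglue, hglue]
        exact (hF.circleOf_right_iff g _ _).2 (Quot.sound (Or.inr rfl)))⟩
  let M₁ : MultiplyCleaved P := ⟨F₁,
    Quot.lift (fun d => M.sign (M.fill.circleOf (g.ends.symm (Sum.inl d))))
      fun d e h => congrArg M.sign ((hF.circleOf_left_iff g d e).2 (Quot.sound h))⟩
  let M₂ : MultiplyCleaved Q := ⟨F₂,
    Quot.lift (fun d => M.sign (M.fill.circleOf (g.ends.symm (Sum.inr d))))
      fun d e h => congrArg M.sign ((hF.circleOf_right_iff g d e).2 (Quot.sound h))⟩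
  exact ⟨L, M₁, M₂, ⟨hF, fun _ => rfl, fun _ => rfl⟩, ⟨hF₁.symm, hmo, fun _ => rfl⟩,
    ⟨rfl, hinside, fun a => congrArg M.sign (hglue a)⟩⟩

/-- The coefficients of the partition map of a glued diagram. -/
theorem coefficient_eq_sum [Finite ι] [Finite κ] [DecidableEq κ] (g : Gluing P Q C)
    (hP : ∀ F : Filling P, ∃ m : NCMatching (n' i), ∀ a,
      F.ConnectedOff (some i) (innerEnd i a) (innerEnd i (m.perm a)))
    (hQ : ∀ F : Filling Q, ∃ m : NCMatching (n' i), ∀ a,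
      F.ConnectedOff none (outerEnd a) (outerEnd (m.perm a)))
    (L₀ : CleavedLink n₀') (L : ∀ s, CleavedLink (compSig n' i n s))
    (Ll : ∀ j : {j : κ // j ≠ i}, CleavedLink (n' j.1)) (Lr : ∀ k, CleavedLink (n k))
    (hl : ∀ j, L (Sum.inl j) = Ll j) (hr : ∀ k, L (Sum.inr k) = Lr k) :
    C.coefficient L₀ L = ∑ K : CleavedLink (n' i),
      P.coefficient L₀ (insertMember (X := fun j => CleavedLink (n' j)) K Ll) *
        Q.coefficient K Lr := by
  classical
  have hins : ∀ (K : CleavedLink (n' i)) (M₁ : MultiplyCleaved P),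
      (∀ j, M₁.HasInnerBoundary j (insertMember (X := fun j => CleavedLink (n' j)) K Ll j)) ↔
      M₁.HasInnerBoundary i K ∧ ∀ j : {j : κ // j ≠ i}, M₁.HasInnerBoundary j.1 (Ll j) := by
    intro K M₁
    constructor
    · intro h
      constructor
      · have := h i
        rwa [insertMember_self (X := fun j => CleavedLink (n' j)) K Ll] at this
      · intro j
        have := h j.1
        rwa [insertMember_of_ne (X := fun j => CleavedLink (n' j)) K Ll] at this
    · rintro ⟨hi, hne⟩ j
      by_cases hj : j = i
      · subst hj
        rwa [insertMember_self (X := fun j => CleavedLink (n' j)) K Ll]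
      · have := hne ⟨j, hj⟩
        rwa [← insertMember_of_ne (X := fun j => CleavedLink (n' j)) K Ll ⟨j, hj⟩] at this
  have hbdry : ∀ {M : MultiplyCleaved C} {M₁ : MultiplyCleaved P} {M₂ : MultiplyCleaved Q},
      g.Decorated M M₁ M₂ → ((M.HasOuterBoundary L₀ ∧ ∀ s, M.HasInnerBoundary s (L s)) ↔
        (M₁.HasOuterBoundary L₀ ∧ ∀ j : {j : κ // j ≠ i}, M₁.HasInnerBoundary j.1 (Ll j)) ∧
          ∀ k, M₂.HasInnerBoundary k (Lr k)) := by
    intro M M₁ M₂ hM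
    rw [hM.hasOuterBoundary_iff, Sum.forall, and_assoc]
    refine and_congr_right fun _ => and_congr (forall_congr' fun j => ?_) (forall_congr' fun k => ?_)
    · rw [← hl]
      exact hM.hasInnerBoundary_left_iff j _
    · rw [← hr]
      exact hM.hasInnerBoundary_right_iff k _
  unfold ArcDiagram.coefficient
  simp only [Finset.sum_mul_sum, hins, ite_zero_mul_ite_zero, ← Fintype.sum_prod_type']
  rw [← Finset.sum_filter, ← Finset.sum_filter]
  have hex : ∀ x ∈ Finset.univ.filter
      (fun x : CleavedLink (n' i) × MultiplyCleaved P × MultiplyCleaved Q =>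
        (x.2.1.HasOuterBoundary L₀ ∧ x.2.1.HasInnerBoundary i x.1 ∧
          ∀ j : {j : κ // j ≠ i}, x.2.1.HasInnerBoundary j.1 (Ll j)) ∧
        x.2.2.HasOuterBoundary x.1 ∧ ∀ k, x.2.2.HasInnerBoundary k (Lr k)),
      ∃ M, g.Decorated M x.2.1 x.2.2 := fun x hx =>
    g.exists_decorated (Finset.mem_filter.1 hx).2.1.2.1 (Finset.mem_filter.1 hx).2.2.1
  symm
  -- Gluing sends `(K, M₁, M₂)` to the glued link. Injectivity is `parts_unique`, surjectivity is
  -- cutting, where planarity enters, and the summands agree because weights multiply.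
  refine Finset.sum_bij (fun x hx => (hex x hx).choose) ?_ ?_ ?_ ?_
  · intro x hx
    obtain ⟨-, ⟨h1, -, h2⟩, -, h3⟩ := Finset.mem_filter.1 hx
    exact Finset.mem_filter.2 ⟨Finset.mem_univ _,
      (hbdry (hex x hx).choose_spec).2 ⟨⟨h1, h2⟩, h3⟩⟩
  · intro x hx y hy hxy
    obtain ⟨-, ⟨-, h1, -⟩, h2, -⟩ := Finset.mem_filter.1 hx
    obtain ⟨-, ⟨-, h1', -⟩, h2', -⟩ := Finset.mem_filter.1 hy
    have hd := (hex x hx).choose_spec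
    rw [show (hex x hx).choose = (hex y hy).choose from hxy] at hd
    obtain ⟨e₁, e₂, e₃⟩ := hd.parts_unique h1 h2 (hex y hy).choose_spec h1' h2'
    exact Prod.ext e₁ (Prod.ext e₂ e₃)
  · intro M hM
    obtain ⟨K, M₁, M₂, hd, h1, h2⟩ := g.exists_parts hP hQ M
    obtain ⟨⟨h3, h4⟩, h5⟩ := (hbdry hd).1 (Finset.mem_filter.1 hM).2
    refine ⟨(K, M₁, M₂), Finset.mem_filter.2 ⟨Finset.mem_univ _, ⟨h3, h1, h4⟩, h2, h5⟩, ?_⟩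
    exact Decorated.unique (Exists.choose_spec (p := fun M => g.Decorated M M₁ M₂) _) hd
  · intro x hx
    exact (hex x hx).choose_spec.weight_eq.symm

end Gluing

/-! ### Partition maps of compositions -/

section LinearAlgebra

variable {κ ι : Type*} {n' : κ → ℕ} {n₀' : ℕ} {n : ι → ℕ} {i : κ}

theorem ArcDiagram.partitionMap_tprod_single [Finite ι] {n₀ : ℕ} (P : ArcDiagram n n₀)
    (L : ∀ i, CleavedLink (n i)) :
    P.partitionMap (PiTensorProduct.tprod Coeff fun i => Finsupp.single (L i) 1) =
      ∑ L₀ : CleavedLink n₀, Finsupp.single L₀ (P.coefficient L₀ L) := by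
  have h : (PiTensorProduct.tprod Coeff fun i => (Finsupp.single (L i) 1 : CleavedModule (n i))) =
      Basis.piTensorProduct (R := Coeff) (M := fun i => CleavedModule (n i))
        (fun _ => Finsupp.basisSingleOne) L := by
    rw [Basis.piTensorProduct_apply]
    simp
  rw [h, ArcDiagram.partitionMap, Module.Basis.constr_basis]

/-- This form displays the dependence on `g` through a linear map in the slot `i`, so that sums and
scalars can be moved out. -/
theorem compValue_eq [DecidableEq κ]
    (f : (⨂[Coeff] j, CleavedModule (n' j)) →ₗ[Coeff] CleavedModule n₀')
    (g : (⨂[Coeff] k, CleavedModule (n k)) →ₗ[Coeff] CleavedModule (n' i))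
    (a : ∀ j : {j : κ // j ≠ i}, CleavedModule (n' j.1)) (b : ∀ k, CleavedModule (n k)) :
    compValue i f g a b = f ((PiTensorProduct.tprod Coeff).toLinearMap (insertAt 0 a) i
      (g (PiTensorProduct.tprod Coeff b))) := by
  rw [compValue, insertAt_eq_update]
  rfl

/-- Bilinearity of composition, stated for weighted sums because the partition maps are sums over
resolutions. -/
theorem compAt_sum_smul [DecidableEq κ] {A B : Type*} [Fintype A] [Fintype B]
    (c : A → Coeff) (f : A → (⨂[Coeff] j, CleavedModule (n' j)) →ₗ[Coeff] CleavedModule n₀')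
    (d : B → Coeff) (g : B → (⨂[Coeff] k, CleavedModule (n k)) →ₗ[Coeff] CleavedModule (n' i)) :
    compAt i (∑ x, c x • f x) (∑ y, d y • g y) =
      ∑ x, ∑ y, (c x * d y) • compAt i (f x) (g y) := by
  refine PiTensorProduct.ext (MultilinearMap.ext fun x => ?_)
  simp only [LinearMap.compMultilinearMap_apply, compAt_tprod, compValue_eq, LinearMap.sum_apply,
    LinearMap.smul_apply, map_sum, map_smul, Finset.smul_sum, smul_smul]
  rw [Finset.sum_comm]
  simp only [mul_comm]

theorem compAt_smul [DecidableEq κ] (c d : Coeff)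
    (f : (⨂[Coeff] j, CleavedModule (n' j)) →ₗ[Coeff] CleavedModule n₀')
    (g : (⨂[Coeff] k, CleavedModule (n k)) →ₗ[Coeff] CleavedModule (n' i)) :
    compAt i (c • f) (d • g) = (c * d) • compAt i f g := by
  have := compAt_sum_smul (fun _ : Unit => c) (fun _ => f) (fun _ : Unit => d) (fun _ => g)
  simpa using this

theorem insertAt_single [DecidableEq κ] (K : CleavedLink (n' i))
    (L : ∀ j : {j : κ // j ≠ i}, CleavedLink (n' j.1)) :
    insertAt (Finsupp.single K 1) (fun j => Finsupp.single (L j) 1) =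
      fun j => (Finsupp.single (insertMember (X := fun j => CleavedLink (n' j)) K L j) 1 :
        CleavedModule (n' j)) := by
  funext j
  by_cases hj : j = i
  · subst hj
    rw [insertAt_self, insertMember_self (X := fun j => CleavedLink (n' j)) K L]
  · have := insertMember_of_ne (X := fun j => CleavedLink (n' j)) K L ⟨j, hj⟩
    rw [insertAt_of_ne _ _ _ hj]
    exact congrArg (fun L => Finsupp.single L 1) this.symm

/-- Composition of partition maps of crossingless diagrams. -/
theorem Gluing.partitionMap_eq [Finite ι] [Finite κ] [DecidableEq κ] {P : ArcDiagram n' n₀'}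
    {Q : ArcDiagram n (n' i)} {C : ArcDiagram (compSig n' i n) n₀'} (g : Gluing P Q C)
    (hP : ∀ F : Filling P, ∃ m : NCMatching (n' i), ∀ a,
      F.ConnectedOff (some i) (innerEnd i a) (innerEnd i (m.perm a)))
    (hQ : ∀ F : Filling Q, ∃ m : NCMatching (n' i), ∀ a,
      F.ConnectedOff none (outerEnd a) (outerEnd (m.perm a))) :
    C.partitionMap = compAt i P.partitionMap Q.partitionMap := by
  refine (Basis.piTensorProduct (R := Coeff) (M := fun s => CleavedModule (compSig n' i n s))
    fun _ => Finsupp.basisSingleOne).ext fun L => ?_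
  let Ll : ∀ j : {j : κ // j ≠ i}, CleavedLink (n' j.1) := fun j => L (Sum.inl j)
  let Lr : ∀ k, CleavedLink (n k) := fun k => L (Sum.inr k)
  rw [Basis.piTensorProduct_apply]
  simp only [Finsupp.coe_basisSingleOne]
  rw [C.partitionMap_tprod_single, compAt_tprod]
  have h : compValue i P.partitionMap Q.partitionMap
      (leftPart fun s => (Finsupp.single (L s) 1 : CleavedModule (compSig n' i n s)))
      (rightPart fun s => Finsupp.single (L s) 1) =
      compValue i P.partitionMap Q.partitionMap (fun j => Finsupp.single (Ll j) 1)
        (fun k => Finsupp.single (Lr k) 1) := rfl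
  -- Expanding the inner value in the basis makes the sum over the link `K` on the glued circle
  -- appear.
  rw [h, compValue_eq, Q.partitionMap_tprod_single, map_sum, map_sum]
  have hK : ∀ K : CleavedLink (n' i), P.partitionMap ((PiTensorProduct.tprod Coeff).toLinearMap
      (insertAt 0 fun j => Finsupp.single (Ll j) 1) i (Finsupp.single K (Q.coefficient K Lr))) =
      ∑ L₀, Finsupp.single L₀ (P.coefficient L₀
        (insertMember (X := fun j => CleavedLink (n' j)) K Ll) * Q.coefficient K Lr) := by
    intro K
    have h1 : Finsupp.single K (Q.coefficient K Lr) =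
        Q.coefficient K Lr • (Finsupp.single K 1 : CleavedModule (n' i)) := by
      rw [Finsupp.smul_single, smul_eq_mul, mul_one]
    have h2 : (PiTensorProduct.tprod Coeff).toLinearMap
        (insertAt 0 fun j => Finsupp.single (Ll j) 1) i (Finsupp.single K 1) =
        PiTensorProduct.tprod Coeff (fun j => (Finsupp.single
          (insertMember (X := fun j => CleavedLink (n' j)) K Ll j) 1 : CleavedModule (n' j))) := by
      rw [← insertAt_single, insertAt_eq_update (Finsupp.single K 1)]
      rfl
    rw [h1, map_smul, map_smul, h2, P.partitionMap_tprod_single, Finset.smul_sum]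
    refine Finset.sum_congr rfl fun L₀ _ => ?_
    rw [Finsupp.smul_single, smul_eq_mul, mul_comm]
  rw [Finset.sum_congr rfl fun K _ => hK K, Finset.sum_comm]
  refine Finset.sum_congr rfl fun L₀ _ => ?_
  rw [g.coefficient_eq_sum hP hQ L₀ L Ll Lr (fun _ => rfl) (fun _ => rfl), Finsupp.single_finsetSum]

end LinearAlgebra

/-! ### Sums over resolutions -/

namespace OrientedTangleDiagram

variable {κ ι : Type*} {n' : κ → ℕ} {n₀' : ℕ} {n : ι → ℕ} (i : κ)
  (R : OrientedTangleDiagram n' n₀') (T : OrientedTangleDiagram n (n' i))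
  (h : OrientationsAgree i R T)

/-- A resolution of a composition is glued from resolutions of the two parts. -/
def compGluing (ρ : R.X → Fin 2) (τ : T.X → Fin 2) :
    Gluing (R.resolve ρ) (T.resolve τ) ((comp i R T h).resolve (Sum.elim ρ τ)) where
  ends := unglueEquiv i R T
  ends_edge e := by
    change unglueEquiv i R T ((unglueEquiv i R T).symm _) = _
    rw [Equiv.apply_symm_apply]
    rfl
  ends_outer _ := rfl
  ends_left _ _ := rfl
  ends_right _ _ := rfl
  exists_pt_left := by
    rintro (⟨x, k⟩ | p)
    · exact ⟨Sum.inl (Sum.inl x, k), rfl, rfl⟩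
    · exact ⟨Sum.inr (Sum.inl (Sum.inl p)), rfl, rfl⟩
  exists_pt_right := by
    rintro (⟨x, k⟩ | p)
    · exact ⟨Sum.inl (Sum.inr x, k), rfl, rfl⟩
    · exact ⟨Sum.inr (Sum.inl (Sum.inr p)), rfl, rfl⟩
  exists_pt_glued a := ⟨Sum.inr (Sum.inr (Sum.inl a)), rfl, rfl⟩

/-- Positivity reads only the orientations at the four ends of a crossing, which gluing leaves
unchanged. -/
theorem numPos_comp : (comp i R T h).numPos = R.numPos + T.numPos := by
  have e : {x : R.X ⊕ T.X // (comp i R T h).IsPositive x} ≃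
      {x : R.X // R.IsPositive x} ⊕ {x : T.X // T.IsPositive x} :=
    Equiv.subtypeSum
  unfold numPos
  rw [← Nat.card_sum]
  exact Nat.card_congr e

theorem numNeg_comp : (comp i R T h).numNeg = R.numNeg + T.numNeg := by
  have e : {x : R.X ⊕ T.X // ¬ (comp i R T h).IsPositive x} ≃
      {x : R.X // ¬ R.IsPositive x} ⊕ {x : T.X // ¬ T.IsPositive x} :=
    Equiv.subtypeSum
  unfold numNeg
  rw [← Nat.card_sum]
  exact Nat.card_congr e

/-- A resolution of the composition is a pair of resolutions, and its height is the sum of theirs,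
so the double sum factors by bilinearity. -/
theorem unshiftedMap_comp [Finite κ] [DecidableEq κ] [Finite ι] (hR : R.IsPlanar)
    (hT : T.IsPlanar) :
    (comp i R T h).unshiftedMap = compAt i R.unshiftedMap T.unshiftedMap := by
  unfold unshiftedMap
  rw [compAt_sum_smul, ← Fintype.sum_prod_type']
  let e : ((comp i R T h).X → Fin 2) ≃ (R.X → Fin 2) × (T.X → Fin 2) :=
    Equiv.sumArrowEquivProdArrow R.X T.X (Fin 2)
  refine Fintype.sum_equiv e _ _ fun ρ => ?_
  obtain ⟨⟨ρ, τ⟩, rfl⟩ := e.symm.surjective ρ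
  rw [Equiv.apply_symm_apply, ← pow_add]
  have h1 : ((comp i R T h).resolve (Sum.elim ρ τ)).partitionMap =
      compAt i (R.resolve ρ).partitionMap (T.resolve τ).partitionMap :=
    (compGluing i R T h ρ τ).partitionMap_eq (fun F => R.exists_matching_inner F hR i)
      (fun F => T.exists_matching_outer F hT)
  have h2 : (∑ c : (comp i R T h).X, ((e.symm (ρ, τ) c : Fin 2) : ℕ)) =
      (∑ c, (ρ c : ℕ)) + ∑ c, (τ c : ℕ) := by
    have h3 := Fintype.sum_sum_type fun c : R.X ⊕ T.X => ((e.symm (ρ, τ) c : Fin 2) : ℕ)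
    -- The two sums over the crossings use different `Fintype` instances; reindexing along the
    -- identity reconciles them.
    let e' : (comp i R T h).X ≃ R.X ⊕ T.X := Equiv.refl _
    exact (Fintype.sum_equiv e' _ _ fun _ => rfl).trans h3
  rw [← h1, ← h2]
  rfl

end OrientedTangleDiagram

end CleavedTangle

end

/-! ### The normalised partition maps -/

theorem mainTheorem3 {κ ι : Type*} [Finite κ] [DecidableEq κ] [Finite ι]
    {n' : κ → ℕ} {n₀' : ℕ} {n : ι → ℕ} (i : κ)
    (R : CleavedTangle.OrientedTangleDiagram n' n₀')
    (T : CleavedTangle.OrientedTangleDiagram n (n' i))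
    (hR : R.IsPlanar) (hT : T.IsPlanar)
    (h : CleavedTangle.OrientationsAgree i R T) :
    (CleavedTangle.OrientedTangleDiagram.comp i R T h).partitionMap =
      CleavedTangle.compAt i R.partitionMap T.partitionMap := by
  unfold CleavedTangle.OrientedTangleDiagram.partitionMap
  rw [CleavedTangle.compAt_smul,
    CleavedTangle.OrientedTangleDiagram.unshiftedMap_comp i R T h hR hT,
    CleavedTangle.OrientedTangleDiagram.numPos_comp,
    CleavedTangle.OrientedTangleDiagram.numNeg_comp]
  congr 1
  -- The normalising factor is multiplicative since both crossing numbers are additive.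
  rw [mul_mul_mul_comm, ← pow_add, ← LaurentPolynomial.T_add]
  congr 2
  push_cast
  ring
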